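/- A Dyck path of length $2n$ is a word with $n$ letters $U$ and $n$ letters $D$ in which every initial segment has at least as many $U$'s as $D$'s. A $k$-ascent of it is a maximal block of $k\ge 1$ consecutive $U$'s. For $m\ge 1$ let $\mathcal F^m(k)$ be the set of $m$-generalized Fibonacci paths of length $2k$, i.e. of the Dyck paths of length $2k$ that have the form $U^{k_1}D^{k_1}U^{k_2}D^{k_2}\cdots U^{k_r}D^{k_r}$ ($r\ge 0$) with $1\le k_j\le m$ for all $j$. Let $\mathcal D^{\mathfrak F^m}(n)$ be the set of Dyck paths of length $2n$ each of whose ascents is coloured, a $k$-ascent by an element of $\mathcal F^m(k)$. Theorem 3. Let $m\ge 1$ and $n\ge 0$. There is a bijection between the finite set $\mathcal D^{\mathfrak F^m}(n)$ and the finite set of dissections of a labelled convex $(n+2)$-gon, by pairwise non-crossing diagonals, into $3$-, $4$-, $\dots$, $(m+2)$-gons (for $n=0$ the degenerate $2$-gon has exactly one dissection, the empty one). If $n\ge 1$, the cardinality of both sets is $$\sum_{\ell=0}^{n-1}\frac{1}{\ell+1}\binom{n+\ell+1}{\ell}\sum_{i=0}^{\ell+1}(-1)^i\binom{n-1-mi}{\ell}\binom{\ell+1}{i},$$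 where $\binom{a}{b}=0$ for every integer $a<0$ and every integer $b\ge 0$. -/

import Mathlib

/-- The lengths, from left to right, of the ascents of a word in the letters `U` and `D`, i.e. of its
maximal (non-empty) blocks of consecutive letters `U`: these are the non-empty pieces
into which the letters `D` cut the word. -/
def ascentLengths (w : List DyckStep) : List ℕ :=
  ((w.splitOn DyckStep.D).map List.length).filter (fun k => 0 < k)

/-- Dyck paths of length `2 n` with ascents coloured by the family `L`: a Dyck path together with
a list of colours, one for each ascent (from left to right), where the colour of
a `k`-ascent belongs to `L k`. -/
def colouredDyckPaths {γ : Type*} (L : ℕ → Set γ) (n : ℕ) : Set (DyckWord × List γ) :=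
  {P | P.1.semilength = n ∧ List.Forall₂ (fun k C => C ∈ L k) (ascentLengths P.1.toList) P.2}

/-- The word `U ^ k D ^ k` of the pyramid of length `2 k`. -/
def pyramidWord (k : ℕ) : List DyckStep :=
  List.replicate k DyckStep.U ++ List.replicate k DyckStep.D

/-- The `m`-generalized Fibonacci paths of length `2 n`: the Dyck paths of length `2 n` that are
concatenations of (non-empty) pyramids of length at most `2 m`. -/
def fibonacciPaths (m n : ℕ) : Set DyckWord :=
  {F | F.semilength = n ∧
    ∃ ks : List ℕ, (∀ k ∈ ks, 1 ≤ k ∧ k ≤ m) ∧ F.toList = ks.flatMap pyramidWord}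

/-- The segment from `a` to `b` (where `a < b`) is a side of the convex polygon with vertices
`0, 1, …, N - 1` in this cyclic order. -/
def IsPolygonSide {N : ℕ} (a b : Fin N) : Prop :=
  a.val + 1 = b.val ∨ (a.val = 0 ∧ b.val + 1 = N)

/-- The pair `e` of vertices of a convex `N`-gon, written in increasing order, is a diagonal. -/
def IsDiagonal {N : ℕ} (e : Fin N × Fin N) : Prop :=
  e.1 < e.2 ∧ ¬ IsPolygonSide e.1 e.2

/-- Two diagonals, written in increasing order, cross in the interior of the convex polygon. -/
def Crosses {N : ℕ} (e f : Fin N × Fin N) : Prop :=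
  (e.1 < f.1 ∧ f.1 < e.2 ∧ e.2 < f.2) ∨ (f.1 < e.1 ∧ e.1 < f.2 ∧ f.2 < e.2)

/-- For vertices `a < b` in `S`: they are neighbours in the cyclic order on `S`, i.e. they span a
side of the convex polygon with vertex set `S`. -/
def IsConsecutive {N : ℕ} (S : Finset (Fin N)) (a b : Fin N) : Prop :=
  (∀ c ∈ S, ¬ (a < c ∧ c < b)) ∨ (∀ c ∈ S, a ≤ c ∧ c ≤ b)

/-- `S` is the vertex set of one of the polygons into which the set `d` of diagonals cuts the
convex `N`-gon: every side of the polygon on `S` is a side of the `N`-gon or belongs to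
`d`, and no diagonal of the polygon on `S` belongs to `d`. -/
def IsPiece {N : ℕ} (d : Finset (Fin N × Fin N)) (S : Finset (Fin N)) : Prop :=
  3 ≤ S.card ∧
    ∀ a ∈ S, ∀ b ∈ S, a < b → (IsConsecutive S a b ↔ (IsPolygonSide a b ∨ (a, b) ∈ d))

/-- The dissections of a convex `N`-gon with labelled vertices into `i`-gons with `3 ≤ i ≤ k`, each
dissection being given by its set of pairwise non-crossing diagonals. -/
def dissections (N k : ℕ) : Set (Finset (Fin N × Fin N)) :=
  {d | (∀ e ∈ d, IsDiagonal e) ∧ (∀ e ∈ d, ∀ f ∈ d, ¬ Crosses e f) ∧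
    ∀ S : Finset (Fin N), IsPiece d S → S.card ≤ k}

/-- The binomial coefficient with an integer upper entry `a`, equal to `0` if `a < 0`. -/
def binom (a : ℤ) (b : ℕ) : ℕ :=
  if 0 ≤ a then a.toNat.choose b else 0

/-- The double sum `∑ 1 / (ℓ + 1) * C(n + ℓ + 1, ℓ) * ∑ (-1) ^ i * C(n - 1 - m i, ℓ) * C(ℓ + 1, i)`
over `0 ≤ ℓ ≤ n - 1` and `0 ≤ i ≤ ℓ + 1`. -/
def dissectionSum (m n : ℕ) : ℚ :=
  ∑ l ∈ Finset.range n, 1 / ((l : ℚ) + 1) * ((n + l + 1).choose l : ℚ) *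
    ∑ i ∈ Finset.range (l + 2),
      (-1 : ℚ) ^ i * (binom ((n : ℤ) - 1 - (m : ℤ) * (i : ℤ)) l : ℚ) * ((l + 1).choose i : ℚ)

/-! Both sets are encoded by the Łukasiewicz words of plane trees with `n + 1` leaves whose inner
vertices have between `2` and `m + 1` children (`lukWords m n 1`), and these words are counted.

A dissected polygon with a marked side is such a tree: the marked side is the root, the remaining
sides are the leaves, the diagonals are the other inner vertices, and a piece with `k + 1` sides is
an inner vertex with `k` children. Trees and forests are represented by laminar sets of arcs on `0,
…, p`. Reading a code from its end builds the arc set one arc at a time, and the arc added last can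
be recognised as the longest one ending at `p`; this makes `bijOn_forestArcs` a bijection.

For Dyck paths, read `0` as a down step and `j ≥ 1` as `j` up steps, and drop the final `0`, which
every code has. The number of pending trees minus one becomes the height. A maximal run of nonzero
letters becomes one ascent, and the letters of the run form a composition of its length into parts
at most `m`, which is the same as a Fibonacci path colouring that ascent (`bijOn_lukColouredPath`).

Removing the first letter of a code gives a recurrence for the number of codes. `forestCount_succ`
shows that a closed form of Lagrange inversion type obeys it, and `compCount_eq_sum` expands the
composition numbers in that form as the inner alternating sum. -/

/-! ### Composition numbers and the closed formula for forests. -/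

/-- The polynomial `X + X ^ 2 + ⋯ + X ^ m`. -/
noncomputable def partPoly (m : ℕ) : Polynomial ℚ := ∑ j ∈ Finset.Icc 1 m, Polynomial.X ^ j

/-- The number of compositions of `n` into `l` parts from `1, …, m`. -/
noncomputable def compCount (m n l : ℕ) : ℚ := (partPoly m ^ l).coeff n

/-- The number of plane forests with `r` trees and `n + r` leaves, all of whose inner vertices have
between `2` and `m + 1` children. -/
noncomputable def forestCount (m n r : ℕ) : ℚ :=
  if n = 0 then 1 else
    ∑ l ∈ Finset.range n, (r : ℚ) / (l + 1) * ((n + r + l).choose l : ℚ) * compCount m n (l + 1)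

theorem compCount_succ (m n l : ℕ) :
    compCount m n (l + 1) = ∑ j ∈ (Finset.Icc 1 m).filter (· ≤ n), compCount m (n - j) l := by
  unfold compCount
  conv_lhs => rw [pow_succ', partPoly, Finset.sum_mul]
  rw [Polynomial.finsetSum_coeff, Finset.sum_filter]
  exact Finset.sum_congr rfl fun j _ => by rw [Polynomial.coeff_X_pow_mul']; rfl

/-- By symmetry, the first of `l + 1` parts with sum `n` is `n / (l + 1)` on average. Algebraically,
this compares coefficients in `X (P ^ (l + 1))' = (l + 1) P ^ l · X P'`. -/
theorem sum_mul_compCount (m n l : ℕ) :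
    ∑ j ∈ (Finset.Icc 1 m).filter (· ≤ n), (j : ℚ) * compCount m (n - j) l =
      n / (l + 1) * compCount m n (l + 1) := by
  have key : Polynomial.X * Polynomial.derivative (partPoly m ^ (l + 1)) =
      Polynomial.C ((l : ℚ) + 1) *
        ∑ j ∈ Finset.Icc 1 m, Polynomial.C (j : ℚ) * (Polynomial.X ^ j * partPoly m ^ l) := by
    rw [Polynomial.derivative_pow_succ]
    have hd : Polynomial.X * Polynomial.derivative (partPoly m) =
        ∑ j ∈ Finset.Icc 1 m, Polynomial.C (j : ℚ) * Polynomial.X ^ j := by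
      rw [partPoly, Polynomial.derivative_sum, Finset.mul_sum]
      refine Finset.sum_congr rfl fun j hj => ?_
      obtain ⟨i, rfl⟩ : ∃ i, j = i + 1 := ⟨j - 1, by have := (Finset.mem_Icc.1 hj).1; omega⟩
      simp
      ring
    calc _ = Polynomial.C ((l : ℚ) + 1) * partPoly m ^ l *
          (Polynomial.X * Polynomial.derivative (partPoly m)) := by ring
      _ = _ := by
        rw [hd, mul_assoc, Finset.mul_sum]
        congr 1
        exact Finset.sum_congr rfl fun j _ => by ring
  have h := congrArg (fun p => Polynomial.coeff p n) key
  simp only [Polynomial.coeff_C_mul, Polynomial.finsetSum_coeff, Polynomial.coeff_X_pow_mul'] at h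
  have hx : (Polynomial.X * Polynomial.derivative (partPoly m ^ (l + 1))).coeff n =
      n * compCount m n (l + 1) := by
    cases n with
    | zero => simp
    | succ n =>
      rw [Polynomial.coeff_X_mul, Polynomial.coeff_derivative, compCount]
      push_cast
      ring
  rw [hx] at h
  have hl : (l : ℚ) + 1 ≠ 0 := by positivity
  rw [div_mul_eq_mul_div, eq_div_iff hl, h, mul_comm, Finset.sum_filter]
  simp [compCount]

theorem compCount_eq_zero {m n l : ℕ} (h : n < l) : compCount m n l = 0 := by
  have hdvd : (Polynomial.X : Polynomial ℚ) ∣ partPoly m :=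
    Finset.dvd_sum fun j hj => dvd_pow_self _ (by have := (Finset.mem_Icc.1 hj).1; omega)
  exact (Polynomial.X_pow_dvd_iff.1 (pow_dvd_pow_of_dvd hdvd l)) n h

theorem compCount_zero_right {m n : ℕ} (h : n ≠ 0) : compCount m n 0 = 0 := by
  simp [compCount, Polynomial.coeff_one, h]

theorem compCount_zero_zero (m : ℕ) : compCount m 0 0 = 1 := by
  simp [compCount]

theorem forestCount_zero_left (m r : ℕ) : forestCount m 0 r = 1 := by
  simp [forestCount]

theorem forestCount_zero_right {m n : ℕ} (h : n ≠ 0) : forestCount m n 0 = 0 := by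
  simp [forestCount, h]

theorem forestCount_eq_sum_range {m n r N : ℕ} (hn : n ≠ 0) (hN : n ≤ N) :
    forestCount m n r = ∑ l ∈ Finset.range N,
      (r : ℚ) / (l + 1) * ((n + r + l).choose l : ℚ) * compCount m n (l + 1) := by
  rw [forestCount, if_neg hn]
  refine Finset.sum_subset (Finset.range_mono hN) fun l _ hl => ?_
  rw [compCount_eq_zero (by simpa [Nat.lt_succ_iff] using hl), mul_zero]

/-- Pascal's rule and absorption reduce every binomial to `(n + (r + 1) + l).choose l`. This is the
coefficient identity behind `forestCount_succ`. -/
theorem forestCount_step_coeff (n r l : ℕ) :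
    ((r : ℚ) + 1) / (l + 2) * ((n + (r + 1) + (l + 1)).choose (l + 1) : ℚ) -
      r / (l + 2) * ((n + r + (l + 1)).choose (l + 1) : ℚ) =
    1 / (l + 1) * ((n + (r + 1) + l).choose l : ℚ) * ((r + 1) + n / (l + 2)) := by
  have h1 : (n + (r + 1) + (l + 1)).choose (l + 1) =
      (n + (r + 1) + l).choose l + (n + (r + 1) + l).choose (l + 1) := Nat.choose_succ_succ _ _
  have h2 := Nat.choose_succ_right_eq (n + (r + 1) + l) l
  rw [show n + (r + 1) + l - l = n + (r + 1) by omega] at h2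
  rw [show n + r + (l + 1) = n + (r + 1) + l by ring, h1]
  have h3 : ((n + (r + 1) + l).choose (l + 1) : ℚ) * (l + 1) =
      (n + (r + 1) + l).choose l * (n + (r + 1)) := by exact_mod_cast h2
  have h4 : ((n + (r + 1) + l).choose (l + 1) : ℚ) =
      (n + (r + 1) + l).choose l * (n + (r + 1)) / (l + 1) := by
    rw [eq_div_iff (by positivity), h3]
  push_cast
  rw [h4]
  field_simp
  ring

/-- This is the recurrence of `lukWords_succ`, checked on the closed form. In the sum over `j` the
upper entry `(n - j) + (r + 1 + j) + l` does not depend on `j`, so only the factor `r + 1 + j` must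
be summed against composition numbers. -/
theorem forestCount_succ (m n r : ℕ) :
    forestCount m n (r + 1) = forestCount m n r +
      ∑ j ∈ (Finset.Icc 1 m).filter (· ≤ n), forestCount m (n - j) (r + 1 + j) := by
  rcases n with _ | n
  · simp only [forestCount_zero_left, left_eq_add]
    refine Finset.sum_eq_zero fun j hj => ?_
    simp only [Finset.mem_filter, Finset.mem_Icc] at hj
    omega
  set J := (Finset.Icc 1 m).filter (· ≤ n + 1) with hJ
  -- The term `compCount _ 0` is `1` exactly when `j = n + 1`, where `forestCount` takes its
  -- separate value `1`; this makes the formula uniform in `j`.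
  have hterm : ∀ j ∈ J, forestCount m (n + 1 - j) (r + 1 + j) = compCount m (n + 1 - j) 0 +
      ∑ l ∈ Finset.range n, 1 / ((l : ℚ) + 1) * ((n + 1 + (r + 1) + l).choose l : ℚ) *
        ((r + 1) * compCount m (n + 1 - j) (l + 1) + j * compCount m (n + 1 - j) (l + 1)) := by
    intro j hj
    have hj1 : 1 ≤ j ∧ j ≤ n + 1 := by
      simp only [hJ, Finset.mem_filter, Finset.mem_Icc] at hj; omega
    by_cases hjn : n + 1 - j = 0
    · rw [hjn, forestCount_zero_left, compCount_zero_zero, Finset.sum_eq_zero, add_zero]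
      intro l _
      rw [compCount_eq_zero (Nat.succ_pos l)]
      ring
    · rw [compCount_zero_right hjn, zero_add,
        forestCount_eq_sum_range hjn (show n + 1 - j ≤ n by omega)]
      refine Finset.sum_congr rfl fun l _ => ?_
      rw [show n + 1 - j + (r + 1 + j) + l = n + 1 + (r + 1) + l by omega]
      push_cast
      ring
  rw [Finset.sum_congr rfl hterm, Finset.sum_add_distrib, ← compCount_succ, Finset.sum_comm]
  have hinner : ∀ l ∈ Finset.range n,
      ∑ j ∈ J, 1 / ((l : ℚ) + 1) * ((n + 1 + (r + 1) + l).choose l : ℚ) *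
        ((r + 1) * compCount m (n + 1 - j) (l + 1) + j * compCount m (n + 1 - j) (l + 1)) =
      1 / ((l : ℚ) + 1) * ((n + 1 + (r + 1) + l).choose l : ℚ) *
        ((r + 1) + ((n + 1 : ℕ) : ℚ) / (l + 2)) * compCount m (n + 1) (l + 1 + 1) := by
    intro l _
    rw [← Finset.mul_sum, Finset.sum_add_distrib, ← Finset.mul_sum, ← compCount_succ,
      sum_mul_compCount]
    push_cast
    ring
  -- The summands with `l = 0` are split off: they differ by `compCount m (n + 1) 1`, the total of
  -- the terms `compCount _ 0`.
  rw [Finset.sum_congr rfl hinner, forestCount, forestCount, if_neg n.succ_ne_zero,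
    if_neg n.succ_ne_zero, Finset.sum_range_succ', Finset.sum_range_succ']
  have hl : ∀ l ∈ Finset.range n,
      ((r + 1 : ℕ) : ℚ) / (((l + 1 : ℕ) : ℚ) + 1) *
        ((n + 1 + (r + 1) + (l + 1)).choose (l + 1) : ℚ) * compCount m (n + 1) (l + 1 + 1) =
      (r : ℚ) / (((l + 1 : ℕ) : ℚ) + 1) *
        ((n + 1 + r + (l + 1)).choose (l + 1) : ℚ) * compCount m (n + 1) (l + 1 + 1) +
      1 / ((l : ℚ) + 1) * ((n + 1 + (r + 1) + l).choose l : ℚ) *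
        ((r + 1) + ((n + 1 : ℕ) : ℚ) / (l + 2)) * compCount m (n + 1) (l + 1 + 1) := by
    intro l _
    rw [← forestCount_step_coeff (n + 1) r l]
    push_cast
    ring
  rw [Finset.sum_congr rfl hl, Finset.sum_add_distrib]
  simp
  ring

theorem coeff_invOneSubPow (l k : ℕ) :
    PowerSeries.coeff k (PowerSeries.invOneSubPow ℚ (l + 1)).val = ((l + k).choose l : ℚ) := by
  rw [PowerSeries.invOneSubPow_val_succ_eq_mk_add_choose, PowerSeries.coeff_mk]

/-- Write `X + ⋯ + X ^ m` as `X (1 - X ^ m) / (1 - X)` in power series, raise it to the power `l +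
1`, and expand the numerator and the negative power of `1 - X` binomially. -/
theorem compCount_eq_sum (m n l : ℕ) :
    compCount m n (l + 1) = ∑ i ∈ Finset.range (l + 2),
      (-1 : ℚ) ^ i * (binom ((n : ℤ) - 1 - (m : ℤ) * (i : ℤ)) l : ℚ) * ((l + 1).choose i : ℚ) := by
  have hA : (partPoly m : PowerSeries ℚ) * (1 - PowerSeries.X) =
      PowerSeries.X * (1 - PowerSeries.X ^ m) := by
    have h : partPoly m * (1 - Polynomial.X) = Polynomial.X * (1 - Polynomial.X ^ m) := by
      induction m with
      | zero => simp [partPoly]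
      | succ m ih =>
        have : partPoly (m + 1) = partPoly m + Polynomial.X ^ (m + 1) := by
          rw [partPoly, partPoly, Finset.sum_Icc_succ_top (by omega)]
        rw [this, add_mul, ih]
        ring
    have := congrArg (fun p : Polynomial ℚ => (p : PowerSeries ℚ)) h
    simpa using this
  have hB : ((partPoly m ^ (l + 1) : Polynomial ℚ) : PowerSeries ℚ) =
      PowerSeries.X ^ (l + 1) * (1 - PowerSeries.X ^ m) ^ (l + 1) *
        (PowerSeries.invOneSubPow ℚ (l + 1)).val := by
    have h1 : (1 - PowerSeries.X : PowerSeries ℚ) ^ (l + 1) *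
        (PowerSeries.invOneSubPow ℚ (l + 1)).val = 1 := by
      rw [← PowerSeries.invOneSubPow_inv_eq_one_sub_pow]
      exact (PowerSeries.invOneSubPow ℚ (l + 1)).inv_val
    rw [← mul_pow, ← hA, mul_pow, mul_assoc, h1, mul_one]
    simp
  have hexp : (1 - PowerSeries.X ^ m : PowerSeries ℚ) ^ (l + 1) =
      ∑ i ∈ Finset.range (l + 2), PowerSeries.C ((-1 : ℚ) ^ i * ((l + 1).choose i : ℚ)) *
        PowerSeries.X ^ (m * i) := by
    rw [sub_eq_add_neg, add_comm, add_pow]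
    refine Finset.sum_congr rfl fun i _ => ?_
    rw [neg_pow, pow_mul]
    simp
    ring
  rw [compCount, ← Polynomial.coeff_coe, hB, hexp, Finset.mul_sum, Finset.sum_mul, map_sum]
  refine Finset.sum_congr rfl fun i _ => ?_
  rw [show PowerSeries.X ^ (l + 1) * (PowerSeries.C ((-1 : ℚ) ^ i * ((l + 1).choose i : ℚ)) *
        PowerSeries.X ^ (m * i)) * (PowerSeries.invOneSubPow ℚ (l + 1)).val =
      PowerSeries.C ((-1 : ℚ) ^ i * ((l + 1).choose i : ℚ)) *
        (PowerSeries.X ^ (l + 1 + m * i) * (PowerSeries.invOneSubPow ℚ (l + 1)).val) by ring,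
    PowerSeries.coeff_C_mul, PowerSeries.coeff_X_pow_mul']
  -- If `l + 1 + m * i > n`, the upper entry is either negative, where `binom` is `0` by convention,
  -- or nonnegative and below `l`.
  have hb : (binom ((n : ℤ) - 1 - (m : ℤ) * (i : ℤ)) l : ℚ) =
      if l + 1 + m * i ≤ n then ((n - 1 - m * i).choose l : ℚ) else 0 := by
    have hc : ((m * i : ℕ) : ℤ) = (m : ℤ) * i := by push_cast; ring
    rw [binom, ← hc]
    split_ifs with h1 h2 h2
    · congr 2; omega
    · rw [Nat.choose_eq_zero_of_lt (by omega), Nat.cast_zero]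
    · omega
    · rfl
  rw [hb]
  split_ifs with h
  · rw [coeff_invOneSubPow, show l + (n - (l + 1 + m * i)) = n - 1 - m * i by omega]
    ring
  · ring

theorem forestCount_one {m n : ℕ} (hn : n ≠ 0) : forestCount m n 1 = dissectionSum m n := by
  rw [forestCount, if_neg hn, dissectionSum]
  refine Finset.sum_congr rfl fun l _ => ?_
  rw [compCount_eq_sum, show n + 1 + l = n + l + 1 by ring]
  simp

/-! ### Łukasiewicz words and their number. -/

/-- The word `w` is the concatenation of the prefix codes of `r` plane trees, where `0` stands for a
leaf and `j ≥ 1` for an inner vertex with `j + 1` children, and where `j ≤ m` for all letters. -/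
def IsLuk (m : ℕ) : ℕ → List ℕ → Prop
  | r, [] => r = 0
  | r, j :: w => 1 ≤ r ∧ j ≤ m ∧ IsLuk m (if j = 0 then r - 1 else r + j) w

/-- The prefix codes of forests with `r` trees and `n + r` leaves. -/
def lukWords (m n r : ℕ) : Set (List ℕ) := {w | IsLuk m r w ∧ w.count 0 = n + r}

theorem isLuk_zero_iff {m : ℕ} {w : List ℕ} : IsLuk m 0 w ↔ w = [] := by
  cases w <;> simp [IsLuk]

theorem isLuk_zero_cons {m r : ℕ} {w : List ℕ} :
    IsLuk m r (0 :: w) ↔ 1 ≤ r ∧ IsLuk m (r - 1) w := by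
  simp [IsLuk]

theorem isLuk_succ_cons {m r j : ℕ} {w : List ℕ} :
    IsLuk m r ((j + 1) :: w) ↔ 1 ≤ r ∧ j + 1 ≤ m ∧ IsLuk m (r + (j + 1)) w := by
  simp [IsLuk]

/-- Each tree has a leaf. In `lukWords_succ` this bounds the first letter by `n`, so that `n - j` is
not truncated. -/
theorem IsLuk.le_count {m : ℕ} {w : List ℕ} : ∀ {r : ℕ}, IsLuk m r w → r ≤ w.count 0 := by
  induction w with
  | nil => intro r h; exact le_of_eq h
  | cons j w ih =>
    intro r h
    rcases j with _ | j
    · have := ih (isLuk_zero_cons.1 h).2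
      rw [List.count_cons_self]
      omega
    · have := ih (isLuk_succ_cons.1 h).2.2
      rw [List.count_cons_of_ne (by omega)]
      omega

theorem lukWords_zero_right (m n : ℕ) : lukWords m n 0 = if n = 0 then {[]} else ∅ := by
  ext w
  rw [lukWords, Set.mem_ofPred_eq, isLuk_zero_iff]
  split_ifs with h
  · subst h
    simp only [Set.mem_singleton_iff]
    exact ⟨fun h => h.1, fun h => by simp [h]⟩
  · simp only [Set.mem_empty_iff_false, iff_false]
    rintro ⟨rfl, h'⟩
    simp at h'
    omega

theorem lukWords_succ (m n r : ℕ) :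
    lukWords m n (r + 1) = Set.image (List.cons 0) (lukWords m n r) ∪
      ⋃ j ∈ (Finset.Icc 1 m).filter (· ≤ n),
        Set.image (List.cons j) (lukWords m (n - j) (r + 1 + j)) := by
  ext w
  simp only [lukWords, Set.mem_ofPred_eq, Set.mem_union, Set.mem_image, Set.mem_iUnion,
    Finset.mem_filter, Finset.mem_Icc]
  constructor
  · rintro ⟨h, hc⟩
    rcases w with _ | ⟨_ | j, w⟩
    · simp [IsLuk] at h
    · rw [isLuk_zero_cons] at h
      rw [List.count_cons_self] at hc
      exact Or.inl ⟨w, ⟨h.2, by omega⟩, rfl⟩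
    · rw [isLuk_succ_cons] at h
      rw [List.count_cons_of_ne (by omega)] at hc
      have := h.2.2.le_count
      exact Or.inr ⟨j + 1, ⟨⟨by omega, h.2.1⟩, by omega⟩, w, ⟨h.2.2, by omega⟩, rfl⟩
  · rintro (⟨w, ⟨h, hc⟩, rfl⟩ | ⟨j, ⟨⟨hj1, hjm⟩, hjn⟩, w, ⟨h, hc⟩, rfl⟩)
    · rw [isLuk_zero_cons, List.count_cons_self]
      exact ⟨⟨by omega, h⟩, by omega⟩
    · obtain ⟨j, rfl⟩ : ∃ i, j = i + 1 := ⟨j - 1, by omega⟩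
      rw [isLuk_succ_cons, List.count_cons_of_ne (by omega)]
      exact ⟨⟨by omega, hjm, h⟩, by omega⟩

theorem encard_biUnion_finset {α ι : Type*} [DecidableEq ι] (s : Finset ι) (f : ι → Set α)
    (h : (s : Set ι).PairwiseDisjoint f) :
    (⋃ i ∈ s, f i).encard = ∑ i ∈ s, (f i).encard := by
  induction s using Finset.induction_on with
  | empty => simp
  | insert a s ha ih =>
    rw [Finset.set_biUnion_insert, Set.encard_union_eq, ih, Finset.sum_insert ha]
    · exact h.subset (by simp)
    · rw [Set.disjoint_iUnion₂_right]
      intro i hi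
      exact h (by simp) (by simp [hi]) (by rintro rfl; exact ha hi)

/-- The induction is lexicographic in `(n, r)`: a leading leaf lowers `r` and keeps `n`, while a
leading inner vertex lowers `n` but raises `r`. -/
theorem lukWords_finite_and_ncard (m : ℕ) (n : ℕ) : ∀ r, (lukWords m n r).Finite ∧
    ((lukWords m n r).ncard : ℚ) = forestCount m n r := by
  induction n using Nat.strong_induction_on with
  | _ n ihn =>
    intro r
    induction r with
    | zero =>
      rw [lukWords_zero_right]
      split_ifs with h
      · subst h; simp [forestCount_zero_left]
      · simp [forestCount_zero_right h]
    | succ r ihr =>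
      set J := (Finset.Icc 1 m).filter (· ≤ n) with hJ
      have hJn : ∀ j ∈ J, n - j < n := by
        intro j hj
        simp only [hJ, Finset.mem_filter, Finset.mem_Icc] at hj
        omega
      have henc : (lukWords m n (r + 1)).encard =
          ((lukWords m n r).ncard + ∑ j ∈ J, (lukWords m (n - j) (r + 1 + j)).ncard : ℕ) := by
        rw [lukWords_succ, Set.encard_union_eq, encard_biUnion_finset,
          List.cons_injective.encard_image, ← ihr.1.cast_ncard_eq]
        · push_cast
          congr 1
          refine Finset.sum_congr rfl fun j hj => ?_
          rw [List.cons_injective.encard_image, ((ihn _ (hJn j hj)) _).1.cast_ncard_eq]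
        · intro i _ j _ hij
          rw [Function.onFun, Set.disjoint_left]
          rintro _ ⟨w, _, rfl⟩ ⟨w', _, h⟩
          exact hij (List.cons.inj h).1.symm
        · rw [Set.disjoint_iUnion₂_right]
          intro j hj
          rw [Set.disjoint_left]
          rintro _ ⟨w, _, rfl⟩ ⟨w', _, h⟩
          have := (List.cons.inj h).1
          simp only [Finset.mem_filter, Finset.mem_Icc] at hj
          omega
      refine ⟨Set.finite_of_encard_eq_coe henc, ?_⟩
      rw [Set.ncard_def, henc, ENat.toNat_natCast, forestCount_succ, ← ihr.2]
      push_cast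
      congr 1
      exact Finset.sum_congr rfl fun j hj => ((ihn _ (hJn j hj)) _).2

/-- Only the letter `0` lowers the number of pending trees, so that number can reach zero only
through a `0`. -/
theorem IsLuk.exists_eq_concat {m : ℕ} {w : List ℕ} :
    ∀ {r : ℕ}, IsLuk m (r + 1) w → ∃ u, w = u ++ [0] := by
  induction w with
  | nil => intro r h; simp [IsLuk] at h
  | cons j w ih =>
    intro r h
    rcases j with _ | j
    · have h' := (isLuk_zero_cons.1 h).2
      rcases r with _ | r
      · rw [Nat.add_sub_cancel, isLuk_zero_iff] at h'
        exact ⟨[], by simp [h']⟩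
      · obtain ⟨u, rfl⟩ := ih h'
        exact ⟨0 :: u, rfl⟩
    · have h' := (isLuk_succ_cons.1 h).2.2
      obtain ⟨u, rfl⟩ := ih (r := r + (j + 1)) (by convert h' using 1; ring)
      exact ⟨(j + 1) :: u, rfl⟩

/-! ### Laminar arc sets and their cells. -/

/-- The vertices among `0, …, p` that do not lie strictly below an arc of `E`. -/
def openVertices (p : ℕ) (E : Finset (ℕ × ℕ)) : Finset ℕ :=
  (Finset.range (p + 1)).filter fun v => ∀ e ∈ E, ¬ (e.1 < v ∧ v < e.2)

/-- `E` is a set of pairwise non-crossing arcs on `0, …, p` that contains all arcs `(a, a + 1)`. -/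
structure IsLaminar (p : ℕ) (E : Finset (ℕ × ℕ)) : Prop where
  lt : ∀ {a b}, (a, b) ∈ E → a < b
  le : ∀ {a b}, (a, b) ∈ E → b ≤ p
  unit : ∀ {a}, a < p → (a, a + 1) ∈ E
  noncross : ∀ {a b c d}, (a, b) ∈ E → (c, d) ∈ E → a < c → c < b → b < d → False

/-- The points of `S` are the vertices of a polygon all of whose sides, but none of whose diagonals,
belong to `E`. -/
def IsCell (E : Finset (ℕ × ℕ)) (S : Finset ℕ) : Prop :=
  3 ≤ S.card ∧ ∀ a ∈ S, ∀ b ∈ S, a < b →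
    (((∀ c ∈ S, ¬ (a < c ∧ c < b)) ∨ ∀ c ∈ S, a ≤ c ∧ c ≤ b) ↔ (a, b) ∈ E)

theorem mem_openVertices {p v : ℕ} {E : Finset (ℕ × ℕ)} :
    v ∈ openVertices p E ↔ v ≤ p ∧ ∀ a b, (a, b) ∈ E → a < v → v < b → False := by
  simp only [openVertices, Finset.mem_filter, Finset.mem_range, Nat.lt_succ_iff, Prod.forall,
    not_and]

theorem exists_neighbours {S : Finset ℕ} {t x₀ y₀ : ℕ} (hx₀ : x₀ ∈ S) (hy₀ : y₀ ∈ S)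
    (hx : x₀ < t) (hy : t < y₀) (ht : t ∉ S) :
    ∃ x ∈ S, ∃ y ∈ S, x₀ ≤ x ∧ x < t ∧ t < y ∧ y ≤ y₀ ∧ ∀ c ∈ S, ¬ (x < c ∧ c < y) := by
  have h1 : (S.filter (· < t)).Nonempty := ⟨x₀, by simp [hx₀, hx]⟩
  have h2 : (S.filter (t < ·)).Nonempty := ⟨y₀, by simp [hy₀, hy]⟩
  obtain ⟨hx1, hx2⟩ := Finset.mem_filter.1 (Finset.max'_mem _ h1)
  obtain ⟨hy1, hy2⟩ := Finset.mem_filter.1 (Finset.min'_mem _ h2)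
  refine ⟨_, hx1, _, hy1, Finset.le_max' _ _ (by simp [hx₀, hx]), hx2, hy2,
    Finset.min'_le _ _ (by simp [hy₀, hy]), fun c hc hcc => ?_⟩
  rcases lt_trichotomy c t with h | h | h
  · exact absurd (Finset.le_max' (S.filter (· < t)) c (by simp [hc, h])) (not_le.2 hcc.1)
  · exact ht (h ▸ hc)
  · exact absurd (Finset.min'_le (S.filter (t < ·)) c (by simp [hc, h])) (not_le.2 hcc.2)

namespace IsCell

variable {E E' : Finset (ℕ × ℕ)} {S : Finset ℕ}

theorem exists_base (h : IsCell E S) :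
    ∃ a ∈ S, ∃ b ∈ S, a < b ∧ (∀ c ∈ S, a ≤ c ∧ c ≤ b) ∧ (a, b) ∈ E := by
  have hne : S.Nonempty := Finset.card_pos.1 (by have := h.1; omega)
  have hb : ∀ c ∈ S, S.min' hne ≤ c ∧ c ≤ S.max' hne := fun c hc =>
    ⟨S.min'_le _ hc, S.le_max' _ hc⟩
  have hlt : S.min' hne < S.max' hne :=
    Finset.min'_lt_max'_of_card _ (by have := h.1; omega)
  exact ⟨_, S.min'_mem hne, _, S.max'_mem hne, hlt, hb,
    (h.2 _ (S.min'_mem hne) _ (S.max'_mem hne) hlt).1 (Or.inr hb)⟩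

theorem congr (h : IsCell E S) (hE : ∀ a ∈ S, ∀ b ∈ S, (a, b) ∈ E ↔ (a, b) ∈ E') :
    IsCell E' S :=
  ⟨h.1, fun a ha b hb hab => (h.2 a ha b hb hab).trans (hE a ha b hb)⟩

end IsCell

namespace IsLaminar

variable {p u v : ℕ} {E : Finset (ℕ × ℕ)}

theorem top_mem_openVertices (h : IsLaminar p E) : p ∈ openVertices p E :=
  mem_openVertices.2 ⟨le_rfl, fun _ _ hab _ h2 => absurd (h.le hab) (not_le.2 h2)⟩

theorem zero_mem_openVertices : 0 ∈ openVertices p E :=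
  mem_openVertices.2 ⟨Nat.zero_le _, fun _ _ _ h1 _ => absurd h1 (Nat.not_lt_zero _)⟩

/-- The longest arc from `a` ends at an open vertex: an arc above that end would cross it, be
longer, or cover `a`. Hence consecutive open vertices bound exactly one tree, and a forest has one
tree fewer than open vertices. -/
theorem mem_of_consecutive (h : IsLaminar p E) {a b : ℕ} (ha : a ∈ openVertices p E)
    (hb : b ∈ openVertices p E) (hab : a < b)
    (hc : ∀ c ∈ openVertices p E, ¬ (a < c ∧ c < b)) : (a, b) ∈ E := by
  rw [mem_openVertices] at ha hb
  have hne : ((Finset.range (p + 1)).filter fun w => (a, w) ∈ E).Nonempty :=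
    ⟨a + 1, by simpa using ⟨by omega, h.unit (by omega)⟩⟩
  set w := Finset.max' _ hne with hw
  have hmem : (a, w) ∈ E := (Finset.mem_filter.1 (Finset.max'_mem _ hne)).2
  have hmax : ∀ x, (a, x) ∈ E → x ≤ w := fun x hx =>
    Finset.le_max' _ _ (by simpa using ⟨by have := h.le hx; omega, hx⟩)
  have haw := h.lt hmem
  have hwb : w ≤ b := not_lt.1 fun hlt => hb.2 _ _ hmem hab hlt
  rcases hwb.eq_or_lt with heq | hlt
  · rwa [← heq]
  · exfalso
    refine hc w (mem_openVertices.2 ⟨h.le hmem, fun c d hcd h1 h2 => ?_⟩) ⟨haw, hlt⟩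
    rcases lt_trichotomy a c with h3 | h3 | h3
    · exact h.noncross hmem hcd h3 h1 h2
    · subst h3
      exact absurd (hmax _ hcd) (not_le.2 h2)
    · exact ha.2 _ _ hcd h3 (haw.trans h2)

/-! ### Adding a new leaf -/

theorem insert_leaf (h : IsLaminar p E) : IsLaminar (p + 1) (insert (p, p + 1) E) where
  lt {a b} hab := by
    rcases Finset.mem_insert.1 hab with h1 | h1
    · simp only [Prod.mk.injEq] at h1; omega
    · exact h.lt h1
  le {a b} hab := by
    rcases Finset.mem_insert.1 hab with h1 | h1
    · simp only [Prod.mk.injEq] at h1; omega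
    · exact (h.le h1).trans (Nat.le_succ p)
  unit {a} ha := by
    rcases (Nat.lt_succ_iff.1 ha).eq_or_lt with rfl | h1
    · exact Finset.mem_insert_self _ _
    · exact Finset.mem_insert_of_mem (h.unit h1)
  noncross {a b c d} hab hcd h1 h2 h3 := by
    rcases Finset.mem_insert.1 hab with h4 | h4 <;> rcases Finset.mem_insert.1 hcd with h5 | h5
    · simp only [Prod.mk.injEq] at h4 h5; omega
    · have := h.le h5
      simp only [Prod.mk.injEq] at h4; omega
    · have := h.le h4
      simp only [Prod.mk.injEq] at h5; omega
    · exact h.noncross h4 h5 h1 h2 h3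

theorem leaf_notMem (h : IsLaminar p E) {a : ℕ} : (a, p + 1) ∉ E := fun hm =>
  absurd (h.le hm) (by omega)

theorem openVertices_insert_leaf (h : IsLaminar p E) :
    openVertices (p + 1) (insert (p, p + 1) E) = insert (p + 1) (openVertices p E) := by
  ext x
  simp only [Finset.mem_insert, mem_openVertices, Prod.mk.injEq]
  constructor
  · rintro ⟨h1, h2⟩
    by_cases hx : x = p + 1
    · exact Or.inl hx
    · exact Or.inr ⟨by omega, fun a b hab => h2 a b (Or.inr hab)⟩
  · rintro (rfl | ⟨h1, h2⟩)
    · refine ⟨le_rfl, fun a b hab h3 h4 => ?_⟩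
      rcases hab with ⟨rfl, rfl⟩ | hab
      · omega
      · have := h.le hab; omega
    · refine ⟨by omega, fun a b hab h3 h4 => ?_⟩
      rcases hab with ⟨rfl, rfl⟩ | hab
      · omega
      · exact h2 a b hab h3 h4

theorem card_openVertices_insert_leaf (h : IsLaminar p E) :
    (openVertices (p + 1) (insert (p, p + 1) E)).card = (openVertices p E).card + 1 := by
  rw [h.openVertices_insert_leaf, Finset.card_insert_of_notMem]
  intro hm
  have := (mem_openVertices.1 hm).1
  omega

/-- A cell containing `p + 1` would have its base ending there, but only `(p, p + 1)` does, which
leaves room for two vertices at most. -/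
theorem isCell_insert_leaf_iff (h : IsLaminar p E) {S : Finset ℕ} :
    IsCell (insert (p, p + 1) E) S ↔ IsCell E S := by
  have key : p + 1 ∉ S → ∀ a ∈ S, ∀ b ∈ S, (a, b) ∈ insert (p, p + 1) E ↔ (a, b) ∈ E := by
    intro hp a _ b hb
    rw [Finset.mem_insert, or_iff_right]
    rintro h1
    rw [(Prod.mk.inj h1).2] at hb
    exact hp hb
  constructor
  · intro hS
    refine hS.congr (key fun hp => ?_)
    obtain ⟨a, ha, b, hb, hab, hbd, hmem⟩ := hS.exists_base
    have hb' : b = p + 1 := le_antisymm (h.insert_leaf.le hmem) (hbd _ hp).2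
    subst hb'
    rcases Finset.mem_insert.1 hmem with h1 | h1
    · rw [(Prod.mk.inj h1).1] at hbd
      have hsub : S ⊆ {p, p + 1} := fun c hc => by
        have := hbd c hc
        simp only [Finset.mem_insert, Finset.mem_singleton]; omega
      have := (Finset.card_le_card hsub).trans Finset.card_le_two
      have := hS.1
      omega
    · exact h.leaf_notMem h1
  · intro hS
    refine hS.congr fun a ha b hb => (key (fun hp => ?_) a ha b hb).symm
    obtain ⟨a, ha, b, hb, hab, hbd, hmem⟩ := hS.exists_base
    have := h.le hmem
    have := (hbd _ hp).2
    omega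

/-! ### Joining the last trees under a new root -/

theorem notMem_of_mem_openVertices_between (hu : u ∈ openVertices p E)
    (hvu : v < u) (hup : u < p) : (v, p) ∉ E := fun hm =>
  (mem_openVertices.1 hu).2 _ _ hm hvu hup

theorem insert_root (h : IsLaminar p E) (hv : v ∈ openVertices p E) (hvp : v < p) :
    IsLaminar p (insert (v, p) E) where
  lt {a b} hab := by
    rcases Finset.mem_insert.1 hab with h1 | h1
    · simp only [Prod.mk.injEq] at h1; omega
    · exact h.lt h1
  le {a b} hab := by
    rcases Finset.mem_insert.1 hab with h1 | h1
    · simp only [Prod.mk.injEq] at h1; omega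
    · exact h.le h1
  unit {a} ha := Finset.mem_insert_of_mem (h.unit ha)
  noncross {a b c d} hab hcd h1 h2 h3 := by
    rcases Finset.mem_insert.1 hab with h4 | h4 <;> rcases Finset.mem_insert.1 hcd with h5 | h5
    · simp only [Prod.mk.injEq] at h4 h5; omega
    · have := h.le h5
      simp only [Prod.mk.injEq] at h4; omega
    · obtain ⟨rfl, rfl⟩ := Prod.mk.inj h5
      exact (mem_openVertices.1 hv).2 _ _ h4 h1 h2
    · exact h.noncross h4 h5 h1 h2 h3

theorem mem_openVertices_insert_root {x : ℕ} :
    x ∈ openVertices p (insert (v, p) E) ↔ x ∈ openVertices p E ∧ ¬ (v < x ∧ x < p) := by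
  simp only [mem_openVertices, Finset.mem_insert, Prod.mk.injEq]
  constructor
  · rintro ⟨h1, h2⟩
    exact ⟨⟨h1, fun a b hab => h2 a b (Or.inr hab)⟩, fun h3 =>
      h2 _ _ (Or.inl ⟨rfl, rfl⟩) h3.1 h3.2⟩
  · rintro ⟨⟨h1, h2⟩, h3⟩
    refine ⟨h1, fun a b hab h4 h5 => ?_⟩
    rcases hab with ⟨rfl, rfl⟩ | hab
    · exact h3 ⟨h4, h5⟩
    · exact h2 a b hab h4 h5

theorem isCell_filter_openVertices (h : IsLaminar p E) (hv : v ∈ openVertices p E)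
    (hu : u ∈ openVertices p E) (hvu : v < u) (hup : u < p) :
    IsCell (insert (v, p) E) ((openVertices p E).filter (v ≤ ·)) := by
  have hp := h.top_mem_openVertices
  refine ⟨?_, fun a ha b hb hab => ?_⟩
  · have hsub : ({v, u, p} : Finset ℕ) ⊆ (openVertices p E).filter (v ≤ ·) := by
      intro x hx
      simp only [Finset.mem_insert, Finset.mem_singleton] at hx
      rw [Finset.mem_filter]
      rcases hx with rfl | rfl | rfl
      · exact ⟨hv, le_rfl⟩
      · exact ⟨hu, hvu.le⟩
      · exact ⟨hp, by omega⟩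
    have h3 : ({v, u, p} : Finset ℕ).card = 3 := by
      rw [Finset.card_eq_three]
      exact ⟨v, u, p, by omega, by omega, by omega, rfl⟩
    exact h3 ▸ Finset.card_le_card hsub
  · simp only [Finset.mem_filter] at ha hb ⊢
    rw [Finset.mem_insert]
    constructor
    · rintro (h1 | h1)
      · exact Or.inr (h.mem_of_consecutive ha.1 hb.1 hab fun c hc hcc =>
          h1 c ⟨hc, ha.2.trans hcc.1.le⟩ hcc)
      · have h2 := (h1 v ⟨hv, le_rfl⟩).1
        have h3 := (h1 p ⟨hp, by omega⟩).2
        have h4 := (mem_openVertices.1 hb.1).1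
        exact Or.inl (Prod.ext (le_antisymm h2 ha.2) (le_antisymm h4 h3))
    · rintro (h1 | h1)
      · obtain ⟨rfl, rfl⟩ := Prod.mk.inj h1
        exact Or.inr fun c hc => ⟨hc.2, (mem_openVertices.1 hc.1).1⟩
      · exact Or.inl fun c hc hcc => (mem_openVertices.1 hc.1).2 _ _ h1 hcc.1 hcc.2

/-- The base of `S` must be the new arc, because any other arc reaching `p` from the left of `v`
would cover the open vertex `v`. The sides of `S` then follow the outermost arcs below that base. -/
theorem eq_filter_openVertices_of_isCell (h : IsLaminar p E) (hv : v ∈ openVertices p E)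
    (hu : u ∈ openVertices p E) (hvu : v < u) (hup : u < p) {S : Finset ℕ}
    (hS : IsCell (insert (v, p) E) S) (hvS : v ∈ S) (hpS : p ∈ S) :
    S = (openVertices p E).filter (v ≤ ·) := by
  have hN := h.insert_root hv (hvu.trans hup)
  have hvo := (mem_openVertices.1 hv).2
  have hbd : ∀ c ∈ S, v ≤ c ∧ c ≤ p := by
    obtain ⟨a, ha, b, hb, hab, hbd, hmem⟩ := hS.exists_base
    have hb' : b = p := le_antisymm (hN.le hmem) (hbd _ hpS).2
    subst hb'
    rcases Finset.mem_insert.1 hmem with h1 | h1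
    · rwa [(Prod.mk.inj h1).1] at hbd
    · rcases (hbd v hvS).1.eq_or_lt with rfl | h2
      · exact hbd
      · exact (hvo _ _ h1 h2 (by omega)).elim
  have hside : ∀ x ∈ S, ∀ y ∈ S, x < y → (∀ c ∈ S, ¬ (x < c ∧ c < y)) →
      (x, y) ∈ insert (v, p) E := fun x hx y hy hxy hc => (hS.2 x hx y hy hxy).1 (Or.inl hc)
  ext s
  rw [Finset.mem_filter]
  constructor
  · intro hs
    refine ⟨mem_openVertices.2 ⟨(hbd s hs).2, fun a b hab h1 h2 => ?_⟩, (hbd s hs).1⟩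
    have hbp := h.le hab
    have hvs : v < s := (hbd s hs).1.lt_of_ne (by rintro rfl; exact hvo _ _ hab h1 h2)
    have hva : v ≤ a := not_lt.1 fun h3 => hvo _ _ hab h3 (hvs.trans h2)
    have hsp : s < p := by omega
    have hcross : ∀ x y, (x, y) ∈ insert (v, p) E → ¬ (x < a ∧ a < y ∧ y < b) ∧
        ¬ (a < x ∧ x < b ∧ b < y) := fun x y hxy =>
      ⟨fun h3 => hN.noncross hxy (Finset.mem_insert_of_mem hab) h3.1 h3.2.1 h3.2.2,
        fun h3 => hN.noncross (Finset.mem_insert_of_mem hab) hxy h3.1 h3.2.1 h3.2.2⟩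
    -- Otherwise the side of `S` that jumps over `a` crosses `(a, b)`, since `s ∈ S` lies under that
    -- arc. The same holds for `b`.
    have haS : a ∈ S := by
      by_contra haS
      obtain ⟨x, hx, y, hy, h3, h4, h5, h6, h7⟩ := exists_neighbours hvS hs
        (hva.lt_of_ne (by rintro rfl; exact haS hvS)) h1 haS
      exact (hcross _ _ (hside x hx y hy (h4.trans h5) h7)).1 ⟨h4, h5, by omega⟩
    have hbS : b ∈ S := by
      by_contra hbS
      obtain ⟨x, hx, y, hy, h3, h4, h5, h6, h7⟩ := exists_neighbours hs hpS h2
        (hbp.lt_of_ne (by rintro rfl; exact hbS hpS)) hbS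
      exact (hcross _ _ (hside x hx y hy (h4.trans h5) h7)).2 ⟨by omega, h4, h5⟩
    rcases (hS.2 a haS b hbS (h1.trans h2)).2 (Finset.mem_insert_of_mem hab) with h3 | h3
    · exact h3 s hs ⟨h1, h2⟩
    · have h4 := (h3 v hvS).1
      have h5 := (h3 p hpS).2
      obtain rfl : a = v := le_antisymm h4 hva
      obtain rfl : b = p := le_antisymm hbp h5
      exact notMem_of_mem_openVertices_between hu hvu hup hab
  · rintro ⟨hs, hvs⟩
    rw [mem_openVertices] at hs
    by_contra hsS
    obtain ⟨x, hx, y, hy, h3, h4, h5, h6, h7⟩ := exists_neighbours hvS hpS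
      (hvs.lt_of_ne (by rintro rfl; exact hsS hvS))
      (hs.1.lt_of_ne (by rintro rfl; exact hsS hpS)) hsS
    rcases Finset.mem_insert.1 (hside x hx y hy (h4.trans h5) h7) with h8 | h8
    · obtain ⟨rfl, rfl⟩ := Prod.mk.inj h8
      have hsub : S ⊆ {x, y} := fun c hc => by
        have h9 := hbd c hc
        have h10 := h7 c hc
        simp only [Finset.mem_insert, Finset.mem_singleton]; omega
      have := (Finset.card_le_card hsub).trans Finset.card_le_two
      have := hS.1
      omega
    · exact hs.2 _ _ h8 h4 h5

/-- A new root creates exactly one cell. The open vertex `u` guarantees at least two children; it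
also excludes old cells through both `v` and `p`, whose base would cover `u`. -/
theorem isCell_insert_root_iff (h : IsLaminar p E) (hv : v ∈ openVertices p E)
    (hu : u ∈ openVertices p E) (hvu : v < u) (hup : u < p) {S : Finset ℕ} :
    IsCell (insert (v, p) E) S ↔ IsCell E S ∨ S = (openVertices p E).filter (v ≤ ·) := by
  have key : ¬ (v ∈ S ∧ p ∈ S) →
      ∀ a ∈ S, ∀ b ∈ S, (a, b) ∈ insert (v, p) E ↔ (a, b) ∈ E := by
    intro hn a ha b hb
    rw [Finset.mem_insert, or_iff_right]
    intro h1
    obtain ⟨rfl, rfl⟩ := Prod.mk.inj h1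
    exact hn ⟨ha, hb⟩
  constructor
  · intro hS
    by_cases hn : v ∈ S ∧ p ∈ S
    · exact Or.inr (h.eq_filter_openVertices_of_isCell hv hu hvu hup hS hn.1 hn.2)
    · exact Or.inl (hS.congr (key hn))
  · rintro (hS | rfl)
    · refine hS.congr fun a ha b hb => (key (fun hn => ?_) a ha b hb).symm
      obtain ⟨a, ha, b, hb, hab, hbd, hmem⟩ := hS.exists_base
      have h1 := h.le hmem
      have h2 := (hbd _ hn.2).2
      have h3 := (hbd _ hn.1).1
      exact (mem_openVertices.1 hu).2 _ _ hmem (by omega) (by omega)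
    · exact h.isCell_filter_openVertices hv hu hvu hup

end IsLaminar

namespace IsLaminar

variable {p u v : ℕ} {E : Finset (ℕ × ℕ)}

/-- The new arc hides all vertices of the new cell except its two ends `v` and `p`. -/
theorem card_openVertices_insert_root (h : IsLaminar p E) (hv : v ∈ openVertices p E)
    (hvp : v < p) :
    (openVertices p (insert (v, p) E)).card + ((openVertices p E).filter (v ≤ ·)).card =
      (openVertices p E).card + 2 := by
  set O := openVertices p E with hO
  have h1 : openVertices p (insert (v, p) E) = O.filter fun x => ¬ (v < x ∧ x < p) := by
    ext x
    rw [mem_openVertices_insert_root, Finset.mem_filter]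
  have h2 : insert v (insert p (O.filter fun x => v < x ∧ x < p)) = O.filter (v ≤ ·) := by
    ext x
    have hp := h.top_mem_openVertices
    simp only [Finset.mem_insert, Finset.mem_filter]
    constructor
    · rintro (rfl | rfl | h3)
      · exact ⟨hv, le_rfl⟩
      · exact ⟨hp, hvp.le⟩
      · exact ⟨h3.1, h3.2.1.le⟩
    · rintro ⟨h3, h4⟩
      have h5 := (mem_openVertices.1 h3).1
      by_cases h6 : x = v
      · exact Or.inl h6
      · by_cases h7 : x = p
        · exact Or.inr (Or.inl h7)
        · exact Or.inr (Or.inr ⟨h3, by omega, by omega⟩)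
  rw [h1, ← h2, Finset.card_insert_of_notMem, Finset.card_insert_of_notMem,
    ← Finset.card_filter_add_card_filter_not (s := O) (fun x => v < x ∧ x < p)]
  · ring
  · simp
  · simp only [Finset.mem_insert, Finset.mem_filter]
    omega

theorem exists_between_of_card (h : 3 ≤ ((openVertices p E).filter (v ≤ ·)).card) :
    ∃ u ∈ openVertices p E, v < u ∧ u < p := by
  by_contra! hn
  have hsub : (openVertices p E).filter (v ≤ ·) ⊆ {v, p} := fun x hx => by
    rw [Finset.mem_filter] at hx
    have h1 := (mem_openVertices.1 hx.1).1
    have h2 := hn x hx.1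
    simp only [Finset.mem_insert, Finset.mem_singleton]
    omega
  have := (Finset.card_le_card hsub).trans Finset.card_le_two
  omega

theorem lt_of_mem_of_between (hu : u ∈ openVertices p E) (hvu : v < u) (hup : u < p) {a : ℕ}
    (ha : (a, p) ∈ E) : v < a := by
  by_contra hav
  exact (mem_openVertices.1 hu).2 _ _ ha (by omega) hup

theorem mem_openVertices_of_min (h : IsLaminar p E) {a : ℕ} (ha : (a, p) ∈ E)
    (hmin : ∀ b, (b, p) ∈ E → a ≤ b) : a ∈ openVertices p E := by
  refine mem_openVertices.2 ⟨(h.lt ha).le, fun b c hbc h1 h2 => ?_⟩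
  rcases (h.le hbc).eq_or_lt with rfl | h3
  · exact absurd (hmin _ hbc) (not_le.2 h1)
  · exact h.noncross hbc ha h1 h2 h3

theorem erase_root (h : IsLaminar p E) (hvp : v + 1 < p) : IsLaminar p (E.erase (v, p)) where
  lt hab := h.lt (Finset.mem_of_mem_erase hab)
  le hab := h.le (Finset.mem_of_mem_erase hab)
  unit ha := Finset.mem_erase.2 ⟨by simp only [ne_eq, Prod.mk.injEq]; omega, h.unit ha⟩
  noncross hab hcd := h.noncross (Finset.mem_of_mem_erase hab) (Finset.mem_of_mem_erase hcd)

/-- By `hmin` the leaf is the only arc ending at `p + 1`, so the last vertex can be dropped with it.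
-/
theorem erase_leaf (h : IsLaminar (p + 1) E) (hmin : ∀ b, (b, p + 1) ∈ E → p ≤ b) :
    IsLaminar p (E.erase (p, p + 1)) where
  lt hab := h.lt (Finset.mem_of_mem_erase hab)
  le {a b} hab := by
    obtain ⟨h1, h2⟩ := Finset.mem_erase.1 hab
    have h3 := h.le h2
    have h4 := h.lt h2
    by_contra hb
    obtain rfl : b = p + 1 := by omega
    have := hmin _ h2
    exact h1 (Prod.ext (by simp only; omega) rfl)
  unit {a} ha := Finset.mem_erase.2 ⟨by simp only [ne_eq, Prod.mk.injEq]; omega, h.unit (by omega)⟩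
  noncross hab hcd := h.noncross (Finset.mem_of_mem_erase hab) (Finset.mem_of_mem_erase hcd)

end IsLaminar

/-! ### From codes to arc sets and back. -/

theorem Finset.nth_mem_and_card_filter_lt {O : Finset ℕ} {i : ℕ} (hi : i < O.card) :
    Nat.nth (· ∈ O) i ∈ O ∧ (O.filter (· < Nat.nth (· ∈ O) i)).card = i := by
  have hfin : ∀ hf : (Set.ofPred (· ∈ O)).Finite, i < hf.toFinset.card := fun hf => by
    have : hf.toFinset = O := by ext; simp
    rwa [this]
  refine ⟨Nat.nth_mem i hfin, ?_⟩
  have h := Nat.count_nth hfin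
  rw [Nat.count_eq_card_filter_range] at h
  rw [← h]
  congr 1
  ext x
  simp [h, and_comm]

theorem Finset.nth_card_filter_lt {O : Finset ℕ} {v : ℕ} (hv : v ∈ O) :
    Nat.nth (· ∈ O) (O.filter (· < v)).card = v := by
  have h : Nat.count (· ∈ O) v = (O.filter (· < v)).card := by
    rw [Nat.count_eq_card_filter_range]
    congr 1
    ext x
    simp [and_comm]
  rw [← h]
  exact Nat.nth_count hv

theorem Finset.card_filter_lt_add_card_filter_le (O : Finset ℕ) (v : ℕ) :
    (O.filter (· < v)).card + (O.filter (v ≤ ·)).card = O.card := by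
  simpa only [not_lt] using Finset.card_filter_add_card_filter_not (s := O) (· < v)

/-- The set of arcs of the forest with a given prefix code, together with its number of leaves: each
leaf is an arc of length one, each inner vertex the arc that spans the leaves above it. -/
noncomputable def forestArcs : List ℕ → ℕ × Finset (ℕ × ℕ)
  | [] => (0, ∅)
  | 0 :: w => ((forestArcs w).1 + 1,
      insert ((forestArcs w).1, (forestArcs w).1 + 1) (forestArcs w).2)
  | (j + 1) :: w => ((forestArcs w).1,
      insert (Nat.nth (· ∈ openVertices (forestArcs w).1 (forestArcs w).2)
        ((openVertices (forestArcs w).1 (forestArcs w).2).card - 3 - j), (forestArcs w).1)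
        (forestArcs w).2)

/-- `E` is the set of arcs of a forest with `p` leaves in which each inner vertex has between `2`
and `m + 1` children. -/
structure IsForest (m p : ℕ) (E : Finset (ℕ × ℕ)) : Prop where
  isLaminar : IsLaminar p E
  card_le : ∀ S, IsCell E S → S.card ≤ m + 2

namespace IsForest

variable {m p v : ℕ} {E : Finset (ℕ × ℕ)}

theorem insert_leaf_iff (h : IsLaminar p E) :
    IsForest m (p + 1) (insert (p, p + 1) E) ↔ IsForest m p E :=
  ⟨fun hF => ⟨h, fun S hS => hF.card_le S (h.isCell_insert_leaf_iff.2 hS)⟩,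
    fun hF => ⟨h.insert_leaf, fun S hS => hF.card_le S (h.isCell_insert_leaf_iff.1 hS)⟩⟩

theorem insert_root_iff (h : IsLaminar p E) (hv : v ∈ openVertices p E)
    (h3 : 3 ≤ ((openVertices p E).filter (v ≤ ·)).card) :
    IsForest m p (insert (v, p) E) ↔
      IsForest m p E ∧ ((openVertices p E).filter (v ≤ ·)).card ≤ m + 2 := by
  obtain ⟨u, hu, hvu, hup⟩ := IsLaminar.exists_between_of_card h3
  have hcell := fun S => h.isCell_insert_root_iff (S := S) hv hu hvu hup
  constructor
  · exact fun hF => ⟨⟨h, fun S hS => hF.card_le S ((hcell S).2 (Or.inl hS))⟩,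
      hF.card_le _ ((hcell _).2 (Or.inr rfl))⟩
  · rintro ⟨hF, hc⟩
    refine ⟨h.insert_root hv (hvu.trans hup), fun S hS => ?_⟩
    rcases (hcell S).1 hS with h1 | rfl
    · exact hF.card_le S h1
    · exact hc

theorem empty (m : ℕ) : IsForest m 0 ∅ where
  isLaminar := ⟨by simp, by simp, by simp, by simp⟩
  card_le S hS := by
    obtain ⟨a, _, b, _, _, _, h⟩ := hS.exists_base
    simp at h

end IsForest

/-- The code is processed from its end and trees are added on the right, so the arcs draw the mirror
image of the coded forest. The `r` trees are the gaps between `r + 1` open vertices. -/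
theorem isForest_forestArcs {m : ℕ} {w : List ℕ} : ∀ {r : ℕ}, IsLuk m r w →
    IsForest m (forestArcs w).1 (forestArcs w).2 ∧ (forestArcs w).1 = w.count 0 ∧
      (openVertices (forestArcs w).1 (forestArcs w).2).card = r + 1 := by
  induction w with
  | nil =>
    rintro r rfl
    exact ⟨IsForest.empty m, rfl, rfl⟩
  | cons j w ih =>
    intro r h
    rcases j with _ | j
    · rw [isLuk_zero_cons] at h
      obtain ⟨h1, h2, h3⟩ := ih h.2
      rw [forestArcs, List.count_cons_self, h1.isLaminar.card_openVertices_insert_leaf, h3, ← h2]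
      exact ⟨(IsForest.insert_leaf_iff h1.isLaminar).2 h1, rfl, by omega⟩
    · rw [isLuk_succ_cons] at h
      obtain ⟨h1, h2, h3⟩ := ih h.2.2
      rw [forestArcs, List.count_cons_of_ne (by omega), ← h2]
      generalize (forestArcs w).1 = p at *
      generalize (forestArcs w).2 = E at *
      -- The letter `j + 1` joins the last `j + 2` trees. They start at the open vertex with `j + 2`
      -- open vertices to its right, whose index is `card - 1 - (j + 2)`.
      obtain ⟨hv, hc⟩ := Finset.nth_mem_and_card_filter_lt (O := openVertices p E)
        (i := (openVertices p E).card - 3 - j) (by omega)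
      set v := Nat.nth (· ∈ openVertices p E) ((openVertices p E).card - 3 - j)
      have hT := (openVertices p E).card_filter_lt_add_card_filter_le v
      have hT3 : 3 ≤ ((openVertices p E).filter (v ≤ ·)).card := by omega
      obtain ⟨u, hu, hvu, hup⟩ := IsLaminar.exists_between_of_card hT3
      have := h1.isLaminar.card_openVertices_insert_root hv (hvu.trans hup)
      exact ⟨(IsForest.insert_root_iff h1.isLaminar hv hT3).2 ⟨h1, by omega⟩, rfl, by
        simp only; omega⟩

/-- Peel off the longest arc ending at the last vertex, the root of the last tree. If it has length
one it is a leaf; otherwise it is an inner vertex. -/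
theorem exists_forestArcs_eq {m p : ℕ} {E : Finset (ℕ × ℕ)} (hF : IsForest m p E) :
    ∃ r w, IsLuk m r w ∧ forestArcs w = (p, E) := by
  induction hk : E.card using Nat.strong_induction_on generalizing p E with
  | _ k ih =>
    have hL := hF.isLaminar
    rcases p with _ | p
    · refine ⟨0, [], rfl, ?_⟩
      have : E = ∅ := by
        rw [Finset.eq_empty_iff_forall_notMem]
        rintro ⟨a, b⟩ hab
        have := hL.le hab
        have := hL.lt hab
        omega
      rw [this, forestArcs]
    · have hex : ∃ a, (a, p + 1) ∈ E := ⟨p, hL.unit p.lt_succ_self⟩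
      classical
      have hv := Nat.find_spec hex
      have hmin : ∀ b, (b, p + 1) ∈ E → Nat.find hex ≤ b := fun b hb => Nat.find_min' hex hb
      generalize Nat.find hex = v at *
      have hlt := Finset.card_erase_lt_of_mem hv
      have hvp := hL.lt hv
      have hins := Finset.insert_erase hv
      by_cases hvp' : v = p
      · subst hvp'
        have hL' := hL.erase_leaf hmin
        rw [← hins, IsForest.insert_leaf_iff hL'] at hF
        obtain ⟨r, w, hw, hE⟩ := ih _ (hk ▸ hlt) hF rfl
        refine ⟨r + 1, 0 :: w, isLuk_zero_cons.2 ⟨by omega, hw⟩, ?_⟩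
        rw [forestArcs, hE, hins]
      · have hL' := hL.erase_root (v := v) (by omega)
        set E' := E.erase (v, p + 1) with hE'
        have hvO : v ∈ openVertices (p + 1) E' := by
          have := hL.mem_openVertices_of_min hv hmin
          rw [← hins, IsLaminar.mem_openVertices_insert_root] at this
          exact this.1
        -- The longest remaining arc at `p + 1` is the last child of the removed root. Its left end
        -- `u` is the open vertex strictly between `v` and `p + 1` needed for the cell.
        have hex' : ∃ a, (a, p + 1) ∈ E' := ⟨p, hL'.unit p.lt_succ_self⟩
        have hu := Nat.find_spec hex'
        have hmin' : ∀ b, (b, p + 1) ∈ E' → Nat.find hex' ≤ b := fun b hb => Nat.find_min' hex' hb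
        generalize Nat.find hex' = u at *
        have huO := hL'.mem_openVertices_of_min hu hmin'
        have hup := hL'.lt hu
        obtain ⟨hne, huE⟩ := Finset.mem_erase.1 hu
        have hvu : v < u := (hmin u huE).lt_of_ne (by rintro rfl; exact hne rfl)
        have hT3 : 3 ≤ ((openVertices (p + 1) E').filter (v ≤ ·)).card :=
          (hL'.isCell_filter_openVertices hvO huO hvu hup).1
        rw [← hins, IsForest.insert_root_iff hL' hvO hT3] at hF
        obtain ⟨r, w, hw, hE⟩ := ih _ (hk ▸ hlt) hF.1 rfl
        obtain ⟨-, -, hc⟩ := isForest_forestArcs hw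
        rw [hE] at hc
        simp only at hc
        have hT := (openVertices (p + 1) E').card_filter_lt_add_card_filter_le v
        obtain ⟨j, hj⟩ : ∃ j, ((openVertices (p + 1) E').filter (v ≤ ·)).card = j + 3 :=
          ⟨_ - 3, (Nat.sub_add_cancel hT3).symm⟩
        refine ⟨r - (j + 1), (j + 1) :: w, isLuk_succ_cons.2 ⟨by omega, by omega, ?_⟩, ?_⟩
        · rwa [Nat.sub_add_cancel (by omega)]
        · rw [forestArcs, hE]
          simp only
          rw [show (openVertices (p + 1) E').card - 3 - j =
            ((openVertices (p + 1) E').filter (· < v)).card by omega,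
            Finset.nth_card_filter_lt hvO, hins]

/-- The arc of the first letter is the longest one ending at `p`, and it has length one exactly for
a leaf. Hence the arc set determines the last construction step, which gives injectivity. -/
theorem forestArcs_cons_spec {m r j : ℕ} {w : List ℕ} (h : IsLuk m r (j :: w)) :
    ∃ p v, (forestArcs (j :: w)).1 = p ∧ v < p ∧ (v, p) ∉ (forestArcs w).2 ∧
      (forestArcs (j :: w)).2 = insert (v, p) (forestArcs w).2 ∧
      (∀ a, (a, p) ∈ (forestArcs (j :: w)).2 → v ≤ a) ∧
      (j = 0 → v + 1 = p ∧ (forestArcs w).1 + 1 = p) ∧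
      (j ≠ 0 → v + 1 ≠ p ∧ (forestArcs w).1 = p) := by
  rcases j with _ | j
  · rw [isLuk_zero_cons] at h
    have hL := (isForest_forestArcs h.2).1.isLaminar
    refine ⟨(forestArcs w).1 + 1, (forestArcs w).1, rfl, Nat.lt_succ_self _, hL.leaf_notMem, rfl,
      fun a ha => ?_, fun _ => ⟨rfl, rfl⟩, fun h => absurd rfl h⟩
    rcases Finset.mem_insert.1 ha with h1 | h1
    · exact (Prod.mk.inj h1).1.ge
    · exact (hL.leaf_notMem h1).elim
  · rw [isLuk_succ_cons] at h
    obtain ⟨h1, h2, h3⟩ := isForest_forestArcs h.2.2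
    rw [forestArcs]
    generalize (forestArcs w).1 = p at *
    generalize (forestArcs w).2 = E at *
    obtain ⟨hv, hc⟩ := Finset.nth_mem_and_card_filter_lt (O := openVertices p E)
      (i := (openVertices p E).card - 3 - j) (by omega)
    set v := Nat.nth (· ∈ openVertices p E) ((openVertices p E).card - 3 - j)
    have hT := (openVertices p E).card_filter_lt_add_card_filter_le v
    obtain ⟨u, hu, hvu, hup⟩ := IsLaminar.exists_between_of_card
      (p := p) (v := v) (E := E) (by omega)
    refine ⟨p, v, rfl, hvu.trans hup, IsLaminar.notMem_of_mem_openVertices_between hu hvu hup, rfl,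
      fun a ha => ?_, fun h => absurd h (by omega), fun _ => ⟨by omega, rfl⟩⟩
    rcases Finset.mem_insert.1 ha with h1 | h1
    · exact (Prod.mk.inj h1).1.ge
    · exact (IsLaminar.lt_of_mem_of_between hu hvu hup h1).le

theorem forestArcs_injective {m : ℕ} {w w' : List ℕ} : ∀ {r r' : ℕ}, IsLuk m r w → IsLuk m r' w' →
    forestArcs w = forestArcs w' → w = w' := by
  induction w generalizing w' with
  | nil =>
    intro r r' _ h' heq
    rcases w' with _ | ⟨j, w'⟩
    · rfl
    · obtain ⟨p, v, _, _, _, h1, _⟩ := forestArcs_cons_spec h'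
      rw [← heq, forestArcs] at h1
      exact absurd h1.symm (Finset.insert_ne_empty _ _)
  | cons j w ih =>
    intro r r' h h' heq
    obtain ⟨p, v, hp, hvp, hn, hE, hmin, h0, hs⟩ := forestArcs_cons_spec h
    rcases w' with _ | ⟨j', w'⟩
    · rw [heq, forestArcs] at hE
      exact absurd hE.symm (Finset.insert_ne_empty _ _)
    obtain ⟨p', v', hp', hvp', hn', hE', hmin', h0', hs'⟩ := forestArcs_cons_spec h'
    have hr := (isForest_forestArcs h).2.2
    have hr' := (isForest_forestArcs h').2.2
    rw [heq] at hr hp hE hmin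
    obtain rfl : p = p' := hp.symm.trans hp'
    obtain rfl : v = v' := le_antisymm (hmin _ (by rw [hE']; exact Finset.mem_insert_self _ _))
      (hmin' _ (by rw [hE]; exact Finset.mem_insert_self _ _))
    have hEE : (forestArcs w).2 = (forestArcs w').2 := by
      rw [← Finset.erase_insert hn, ← hE, hE', Finset.erase_insert hn']
    have hrr : r = r' := by omega
    subst hrr
    obtain ⟨-, -, ht⟩ := h
    obtain ⟨-, -, ht'⟩ := h'
    have hpp : (forestArcs w).1 = (forestArcs w').1 ∧ (j = 0 ↔ j' = 0) := by
      by_cases hj : j = 0 <;> by_cases hj' : j' = 0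
      · exact ⟨by have := h0 hj; have := h0' hj'; omega, by simp [hj, hj']⟩
      · exact absurd (h0 hj).1 (hs' hj').1
      · exact absurd (h0' hj').1 (hs hj).1
      · exact ⟨(hs hj).2.trans (hs' hj').2.symm, by simp [hj, hj']⟩
    have hw := ih ht ht' (Prod.ext hpp.1 hEE)
    subst hw
    -- The tails agree, so their numbers of trees agree; compared with the common `r`, this
    -- determines the first letter.
    have h1 := (isForest_forestArcs ht).2.2
    have h2 := (isForest_forestArcs ht').2.2
    have hpp2 := hpp.2
    split_ifs at h1 h2 <;> congr 1 <;> omega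

/-! ### Dissections as arc sets of trees. -/

open scoped Classical in
/-- The sides of the convex `N`-gon together with the diagonals in `d`, as arcs on `0, …, N - 1`. -/
noncomputable def dissectionArcs {N : ℕ} (d : Finset (Fin N × Fin N)) : Finset (ℕ × ℕ) :=
  (Finset.univ.filter fun e : Fin N × Fin N =>
    e.1 < e.2 ∧ (IsPolygonSide e.1 e.2 ∨ e ∈ d)).image fun e => (e.1.val, e.2.val)

theorem mem_dissectionArcs {N : ℕ} {d : Finset (Fin N × Fin N)} {x y : ℕ} :
    (x, y) ∈ dissectionArcs d ↔ ∃ a b : Fin N, a.val = x ∧ b.val = y ∧ a < b ∧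
      (IsPolygonSide a b ∨ (a, b) ∈ d) := by
  simp only [dissectionArcs, Finset.mem_image, Finset.mem_filter, Finset.mem_univ, true_and,
    Prod.exists, Prod.mk.injEq]
  constructor
  · rintro ⟨a, b, h, rfl, rfl⟩
    exact ⟨a, b, rfl, rfl, h⟩
  · rintro ⟨a, b, rfl, rfl, h⟩
    exact ⟨a, b, h, rfl, rfl⟩

theorem val_mem_dissectionArcs {N : ℕ} {d : Finset (Fin N × Fin N)} {a b : Fin N} :
    (a.val, b.val) ∈ dissectionArcs d ↔ a < b ∧ (IsPolygonSide a b ∨ (a, b) ∈ d) := by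
  rw [mem_dissectionArcs]
  constructor
  · rintro ⟨a', b', h1, h2, h⟩
    rwa [Fin.ext h1, Fin.ext h2] at h
  · exact fun h => ⟨a, b, rfl, rfl, h⟩

theorem isCell_map_iff_isPiece {N : ℕ} {d : Finset (Fin N × Fin N)} {S : Finset (Fin N)} :
    IsCell (dissectionArcs d) (S.map Fin.valEmbedding) ↔ IsPiece d S := by
  simp only [IsCell, IsPiece, IsConsecutive, Finset.card_map, Finset.mem_map,
    Fin.valEmbedding_apply, forall_exists_index, and_imp, forall_apply_eq_imp_iff₂,
    val_mem_dissectionArcs, Fin.val_fin_lt, Fin.val_fin_le]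
  refine and_congr_right fun _ => forall₂_congr fun a _ => forall₂_congr fun b _ =>
    forall_congr' fun hab => ?_
  simp only [hab, true_and]

theorem IsCell.exists_eq_map {N : ℕ} {d : Finset (Fin N × Fin N)} {S : Finset ℕ}
    (h : IsCell (dissectionArcs d) S) : ∃ S' : Finset (Fin N), S = S'.map Fin.valEmbedding := by
  obtain ⟨a, _, b, _, _, hbd, hmem⟩ := h.exists_base
  obtain ⟨_, b', _, rfl, _⟩ := mem_dissectionArcs.1 hmem
  refine ⟨Finset.univ.filter fun x => x.val ∈ S, ?_⟩
  ext x
  simp only [Finset.mem_map, Finset.mem_filter, Finset.mem_univ, true_and, Fin.valEmbedding_apply]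
  exact ⟨fun hx => ⟨⟨x, (hbd x hx).2.trans_lt b'.isLt⟩, hx, rfl⟩, fun ⟨y, hy, hyx⟩ => hyx ▸ hy⟩

theorem forall_isCell_card_le_iff {N k : ℕ} {d : Finset (Fin N × Fin N)} :
    (∀ S, IsCell (dissectionArcs d) S → S.card ≤ k) ↔ ∀ S, IsPiece d S → S.card ≤ k := by
  constructor
  · intro h S hS
    simpa using h _ (isCell_map_iff_isPiece.2 hS)
  · intro h S hS
    obtain ⟨S', rfl⟩ := hS.exists_eq_map
    simpa using h _ (isCell_map_iff_isPiece.1 hS)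

theorem isLaminar_dissectionArcs {n : ℕ} {d : Finset (Fin (n + 2) × Fin (n + 2))}
    (hc : ∀ e ∈ d, ∀ f ∈ d, ¬ Crosses e f) : IsLaminar (n + 1) (dissectionArcs d) where
  lt hab := by
    obtain ⟨a, b, rfl, rfl, h, -⟩ := mem_dissectionArcs.1 hab
    exact h
  le hab := by
    obtain ⟨a, b, rfl, rfl, -, -⟩ := mem_dissectionArcs.1 hab
    exact Nat.lt_succ_iff.1 b.isLt
  unit {a} ha := mem_dissectionArcs.2 ⟨⟨a, by omega⟩, ⟨a + 1, by omega⟩, rfl, rfl,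
    by rw [Fin.lt_def]; exact Nat.lt_succ_self a, Or.inl (Or.inl rfl)⟩
  noncross hab hcd h1 h2 h3 := by
    obtain ⟨a, b, rfl, rfl, -, hab'⟩ := mem_dissectionArcs.1 hab
    obtain ⟨c, d, rfl, rfl, -, hcd'⟩ := mem_dissectionArcs.1 hcd
    have := d.isLt
    rcases hab' with (h | h) | hab'
    · omega
    · omega
    · rcases hcd' with (h | h) | hcd'
      · omega
      · omega
      · exact hc _ hab' _ hcd' (Or.inl ⟨h1, h2, h3⟩)

/-- The base `(0, n + 1)` is required because it is a side of the polygon. The diagonals are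
recovered by discarding all sides; for `n = 0` the base is itself the only leaf. -/
theorem bijOn_dissectionArcs (m n : ℕ) :
    Set.BijOn dissectionArcs (dissections (n + 2) (m + 2))
      {E | IsForest m (n + 1) E ∧ (0, n + 1) ∈ E} := by
  refine ⟨?_, ?_, ?_⟩
  · rintro d ⟨_, hc, hS⟩
    refine ⟨⟨isLaminar_dissectionArcs hc, forall_isCell_card_le_iff.2 hS⟩, ?_⟩
    exact mem_dissectionArcs.2 ⟨0, Fin.last _, rfl, rfl, Fin.last_pos, Or.inl (Or.inr ⟨rfl, rfl⟩)⟩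
  · have key : ∀ d ∈ dissections (n + 2) (m + 2), ∀ a b,
        (a, b) ∈ d ↔ IsDiagonal (a, b) ∧ (a.val, b.val) ∈ dissectionArcs d := by
      rintro d ⟨hd, _, _⟩ a b
      rw [val_mem_dissectionArcs]
      exact ⟨fun h => ⟨hd _ h, (hd _ h).1, Or.inr h⟩, fun ⟨h1, _, h2⟩ => h2.resolve_left h1.2⟩
    intro d hd d' hd' h
    ext ⟨a, b⟩
    rw [key d hd, key d' hd', h]
  · rintro E ⟨⟨hL, hS⟩, hbase⟩
    classical
    set d : Finset (Fin (n + 2) × Fin (n + 2)) :=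
      Finset.univ.filter fun e => IsDiagonal e ∧ (e.1.val, e.2.val) ∈ E with hd
    have hdE : dissectionArcs d = E := by
      ext ⟨x, y⟩
      rw [mem_dissectionArcs]
      constructor
      · rintro ⟨a, b, rfl, rfl, hab, (h | h) | h⟩
        · rw [← h]
          exact hL.unit (by have := b.isLt; omega)
        · rw [h.1, show b.val = n + 1 by omega]
          exact hbase
        · exact (Finset.mem_filter.1 h).2.2
      · intro h
        have h1 := hL.lt h
        have h2 := hL.le h
        refine ⟨⟨x, by omega⟩, ⟨y, by omega⟩, rfl, rfl, h1, ?_⟩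
        by_cases hs : IsPolygonSide (⟨x, by omega⟩ : Fin (n + 2)) ⟨y, by omega⟩
        · exact Or.inl hs
        · exact Or.inr (Finset.mem_filter.2 ⟨Finset.mem_univ _, ⟨h1, hs⟩, h⟩)
    refine ⟨d, ⟨fun e he => (Finset.mem_filter.1 he).2.1, fun e he f hf hef => ?_, ?_⟩, hdE⟩
    · have he' := (Finset.mem_filter.1 he).2.2
      have hf' := (Finset.mem_filter.1 hf).2.2
      rcases hef with h | h
      · exact hL.noncross he' hf' h.1 h.2.1 h.2.2
      · exact hL.noncross hf' he' h.1 h.2.1 h.2.2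
    · rw [← forall_isCell_card_le_iff, hdE]
      exact hS

theorem pair_subset_openVertices {p : ℕ} {E : Finset (ℕ × ℕ)} (h : IsLaminar p E) :
    {0, p} ⊆ openVertices p E := by
  intro x hx
  rcases Finset.mem_insert.1 hx with rfl | hx
  · exact IsLaminar.zero_mem_openVertices
  · rw [Finset.mem_singleton.1 hx]
    exact h.top_mem_openVertices

/-- The forest is a single tree exactly when one arc spans all leaves. -/
theorem card_openVertices_eq_two_iff {p : ℕ} {E : Finset (ℕ × ℕ)} (h : IsLaminar p E)
    (hp : 0 < p) : (openVertices p E).card = 2 ↔ (0, p) ∈ E := by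
  have hcard : ({0, p} : Finset ℕ).card = 2 := Finset.card_pair hp.ne
  constructor
  · intro h2
    have heq := Finset.eq_of_subset_of_card_le (pair_subset_openVertices h) (by omega)
    refine h.mem_of_consecutive IsLaminar.zero_mem_openVertices h.top_mem_openVertices hp ?_
    intro c hc hcc
    rw [← heq] at hc
    simp only [Finset.mem_insert, Finset.mem_singleton] at hc
    omega
  · intro hE
    rw [← hcard]
    congr 1
    refine (Finset.Subset.antisymm (pair_subset_openVertices h) fun x hx => ?_).symm
    rw [mem_openVertices] at hx
    have h1 := hx.2 _ _ hE
    simp only [Finset.mem_insert, Finset.mem_singleton]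
    by_contra! hn
    exact h1 (Nat.pos_of_ne_zero hn.1) (hx.1.lt_of_ne hn.2)

theorem bijOn_forestArcs (m n : ℕ) :
    Set.BijOn (fun w => (forestArcs w).2) (lukWords m n 1)
      {E | IsForest m (n + 1) E ∧ (0, n + 1) ∈ E} := by
  refine ⟨?_, ?_, ?_⟩
  · rintro w ⟨hw, hc⟩
    obtain ⟨h1, h2, h3⟩ := isForest_forestArcs hw
    rw [h2, hc] at h1 h3
    exact ⟨h1, (card_openVertices_eq_two_iff h1.isLaminar n.succ_pos).1 h3⟩
  · rintro w ⟨hw, hc⟩ w' ⟨hw', hc'⟩ h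
    refine forestArcs_injective hw hw' (Prod.ext ?_ h)
    rw [(isForest_forestArcs hw).2.1, (isForest_forestArcs hw').2.1, hc, hc']
  · rintro E ⟨hE, hbase⟩
    obtain ⟨r, w, hw, hwE⟩ := exists_forestArcs_eq hE
    obtain ⟨_, h2, h3⟩ := isForest_forestArcs hw
    rw [hwE] at h2 h3
    rw [(card_openVertices_eq_two_iff hE.isLaminar n.succ_pos).2 hbase] at h3
    obtain rfl : r = 1 := by omega
    exact ⟨w, ⟨hw, h2.symm⟩, by simp only [hwE]⟩

theorem Set.BijOn.finite_and_ncard_eq {α β : Type*} {f : α → β} {s : Set α} {t : Set β}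
    (h : Set.BijOn f s t) : (s.Finite ↔ t.Finite) ∧ s.ncard = t.ncard := by
  rw [← h.image_eq]
  exact ⟨(Set.finite_image_iff h.injOn).symm, h.injOn.ncard_image.symm⟩

theorem dissections_finite_and_ncard (m n : ℕ) : (dissections (n + 2) (m + 2)).Finite ∧
    ((dissections (n + 2) (m + 2)).ncard : ℚ) = forestCount m n 1 := by
  obtain ⟨h1, h2⟩ := (bijOn_dissectionArcs m n).finite_and_ncard_eq
  obtain ⟨h3, h4⟩ := (bijOn_forestArcs m n).finite_and_ncard_eq
  obtain ⟨h5, h6⟩ := lukWords_finite_and_ncard m n 1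
  exact ⟨h1.2 (h3.1 h5), by rw [h2, ← h4, h6]⟩

/-! ### Coloured Dyck paths as words. -/

theorem List.splitOn_letters {α : Type*} [DecidableEq α] (a : α) (l : List α) :
    (∀ B ∈ l.splitOn a, ∀ x ∈ B, x ≠ a ∧ x ∈ l) ∧
      ∀ x ∈ l, x = a ∨ ∃ B ∈ l.splitOn a, x ∈ B := by
  induction l with
  | nil => simp
  | cons y l ih =>
    rw [List.splitOn_cons_eq_if_modifyHead]
    obtain ⟨ih1, ih2⟩ := ih
    split_ifs with h
    · have hy : y = a := by simpa using h
      subst hy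
      constructor
      · intro B hB x hx
        rcases List.mem_cons.1 hB with rfl | hB
        · simp at hx
        · exact ⟨(ih1 B hB x hx).1, List.mem_cons_of_mem _ (ih1 B hB x hx).2⟩
      · intro x hx
        rcases List.mem_cons.1 hx with rfl | hx
        · exact Or.inl rfl
        · rcases ih2 x hx with h1 | ⟨B, hB, hxB⟩
          · exact Or.inl h1
          · exact Or.inr ⟨B, List.mem_cons_of_mem _ hB, hxB⟩
    · have hy : y ≠ a := by simpa using h
      obtain ⟨C, Cs, hC⟩ := List.exists_cons_of_ne_nil (List.splitOn_ne_nil a l)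
      rw [hC] at ih1 ih2 ⊢
      rw [List.modifyHead_cons]
      constructor
      · intro B hB x hx
        rcases List.mem_cons.1 hB with rfl | hB
        · rcases List.mem_cons.1 hx with rfl | hx
          · exact ⟨hy, List.mem_cons_self⟩
          · have := ih1 C List.mem_cons_self x hx
            exact ⟨this.1, List.mem_cons_of_mem _ this.2⟩
        · have := ih1 B (List.mem_cons_of_mem _ hB) x hx
          exact ⟨this.1, List.mem_cons_of_mem _ this.2⟩
      · intro x hx
        rcases List.mem_cons.1 hx with rfl | hx
        · exact Or.inr ⟨_, List.mem_cons_self, List.mem_cons_self⟩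
        · rcases ih2 x hx with h1 | ⟨B, hB, hxB⟩
          · exact Or.inl h1
          · rcases List.mem_cons.1 hB with rfl | hB
            · exact Or.inr ⟨_, List.mem_cons_self, List.mem_cons_of_mem _ hxB⟩
            · exact Or.inr ⟨B, List.mem_cons_of_mem _ hB, hxB⟩

theorem DyckStep.eq_U_of_ne_D {s : DyckStep} (h : s ≠ DyckStep.D) : s = DyckStep.U :=
  s.dichotomy.resolve_right h

/-! ### Dyck paths from words -/

/-- Read every letter `0` as a down step and every letter `j ≥ 1` as `j` up steps. -/
def lukPath (w : List ℕ) : List DyckStep :=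
  w.flatMap fun j => if j = 0 then [DyckStep.D] else List.replicate j DyckStep.U

theorem lukPath_zero_cons (w : List ℕ) : lukPath (0 :: w) = DyckStep.D :: lukPath w := by
  simp [lukPath]

theorem lukPath_cons {j : ℕ} (hj : j ≠ 0) (w : List ℕ) :
    lukPath (j :: w) = List.replicate j DyckStep.U ++ lukPath w := by
  simp [lukPath, hj]

theorem splitOn_replicate_U_append (j : ℕ) (l : List DyckStep) :
    (List.replicate j DyckStep.U ++ l).splitOn DyckStep.D =
      (l.splitOn DyckStep.D).modifyHead (List.replicate j DyckStep.U ++ ·) := by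
  obtain ⟨C, Cs, hC⟩ := List.exists_cons_of_ne_nil (List.splitOn_ne_nil DyckStep.D l)
  induction j with
  | zero => simp [hC]
  | succ j ih =>
    rw [List.replicate_succ, List.cons_append, List.splitOn_cons_eq_if_modifyHead, ih, hC]
    simp

theorem splitOn_lukPath (w : List ℕ) : (lukPath w).splitOn DyckStep.D =
    (w.splitOn 0).map fun B => List.replicate B.sum DyckStep.U := by
  induction w with
  | nil => simp [lukPath]
  | cons j w ih =>
    obtain ⟨C, Cs, hC⟩ := List.exists_cons_of_ne_nil (List.splitOn_ne_nil 0 w)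
    rw [List.splitOn_cons_eq_if_modifyHead]
    by_cases hj : j = 0
    · subst hj
      rw [lukPath_zero_cons, List.splitOn_cons_eq_if_modifyHead, ih]
      simp
    · rw [lukPath_cons hj, splitOn_replicate_U_append, ih, hC]
      simp [hj]

theorem count_D_lukPath (w : List ℕ) : (lukPath w).count DyckStep.D = w.count 0 := by
  induction w with
  | nil => rfl
  | cons j w ih =>
    by_cases hj : j = 0
    · subst hj
      rw [lukPath_zero_cons, List.count_cons_self, List.count_cons_self, ih]
    · rw [lukPath_cons hj, List.count_append, List.count_replicate, List.count_cons_of_ne hj, ih]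
      simp

/-- The path `l` that starts at height `h` never goes below height `0` and ends there. -/
def IsDyckFrom : ℕ → List DyckStep → Prop
  | h, [] => h = 0
  | h, DyckStep.U :: l => IsDyckFrom (h + 1) l
  | h, DyckStep.D :: l => 1 ≤ h ∧ IsDyckFrom (h - 1) l

theorem isDyckFrom_iff {l : List DyckStep} : ∀ {h : ℕ}, IsDyckFrom h l ↔
    h + l.count DyckStep.U = l.count DyckStep.D ∧
      ∀ i, (l.take i).count DyckStep.D ≤ h + (l.take i).count DyckStep.U := by
  induction l with
  | nil => intro h; simp [IsDyckFrom]
  | cons s l ih =>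
    intro h
    have htake : ∀ P : List DyckStep → Prop,
        (∀ i, P ((s :: l).take i)) ↔ P [] ∧ ∀ i, P (s :: l.take i) := fun P =>
      ⟨fun H => ⟨H 0, fun i => H (i + 1)⟩, fun H i => by cases i; exacts [H.1, H.2 _]⟩
    rw [htake fun t => t.count DyckStep.D ≤ h + t.count DyckStep.U]
    rcases s with _ | _
    · simp only [IsDyckFrom, ih, List.count_nil, List.count_cons_self, Nat.zero_le, true_and,
        List.count_cons_of_ne (show DyckStep.U ≠ DyckStep.D by decide)]
      exact and_congr (by omega) (forall_congr' fun i => by omega)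
    · simp only [IsDyckFrom, ih, List.count_nil, List.count_cons_self, Nat.zero_le, true_and,
        List.count_cons_of_ne (show DyckStep.D ≠ DyckStep.U by decide)]
      constructor
      · rintro ⟨h1, h2, h3⟩
        exact ⟨by omega, fun i => by have := h3 i; omega⟩
      · rintro ⟨h1, h2⟩
        have h0 := h2 0
        simp only [List.take_zero, List.count_nil] at h0
        exact ⟨by omega, by omega, fun i => by have := h2 i; omega⟩

theorem isDyckFrom_replicate_U_append {j h : ℕ} {l : List DyckStep} :
    IsDyckFrom h (List.replicate j DyckStep.U ++ l) ↔ IsDyckFrom (h + j) l := by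
  induction j generalizing h with
  | zero => simp
  | succ j ih =>
    rw [List.replicate_succ, List.cons_append, IsDyckFrom, ih, add_right_comm, add_assoc]

/-- The height is the number of pending trees minus one. A code needs a pending tree before each
letter, including the final `0`, so the height without that `0` stays nonnegative and ends at zero.
-/
theorem isLuk_concat_zero_iff {m : ℕ} {w : List ℕ} : ∀ {h : ℕ},
    IsLuk m (h + 1) (w ++ [0]) ↔ (∀ j ∈ w, j ≤ m) ∧ IsDyckFrom h (lukPath w) := by
  induction w with
  | nil => intro h; simp [IsLuk, lukPath, IsDyckFrom]
  | cons j w ih =>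
    intro h
    rw [List.cons_append, List.forall_mem_cons]
    rcases j with _ | j
    · rw [isLuk_zero_cons, lukPath_zero_cons, IsDyckFrom, Nat.add_sub_cancel]
      rcases h with _ | h
      · simp [isLuk_zero_iff]
      · rw [ih, Nat.add_sub_cancel]
        simp
    · rw [isLuk_succ_cons, lukPath_cons j.succ_ne_zero, isDyckFrom_replicate_U_append,
        add_right_comm, ih]
      constructor
      · exact fun H => ⟨⟨H.2.1, H.2.2.1⟩, H.2.2.2⟩
      · exact fun H => ⟨by omega, H.1.1, H.1.2, H.2⟩

theorem DyckWord.isDyckFrom (P : DyckWord) : IsDyckFrom 0 P.toList :=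
  isDyckFrom_iff.2 ⟨by rw [zero_add]; exact P.count_U_eq_count_D, fun i => by
    rw [zero_add]; exact P.count_D_le_count_U i⟩

theorem IsDyckFrom.exists_dyckWord {l : List DyckStep} (h : IsDyckFrom 0 l) :
    ∃ P : DyckWord, P.toList = l := by
  rw [isDyckFrom_iff] at h
  simp only [zero_add] at h
  exact ⟨⟨l, h.1, h.2⟩, rfl⟩

/-! ### Fibonacci paths from compositions -/

/-- The pyramid of length `2 k`. -/
def pyramid (k : ℕ) : DyckWord where
  toList := pyramidWord k
  count_U_eq_count_D := by simp [pyramidWord, List.count_append, List.count_replicate]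
  count_D_le_count_U i := by
    simp only [pyramidWord, List.take_append, List.take_replicate, List.length_replicate,
      List.count_append, List.count_replicate]
    simp

/-- The concatenation of the pyramids of lengths `2 k` for `k` in the list `ks`. -/
def pyramids (ks : List ℕ) : DyckWord := (ks.map pyramid).sum

theorem toList_pyramids (ks : List ℕ) : (pyramids ks).toList = ks.flatMap pyramidWord := by
  induction ks with
  | nil => rfl
  | cons k ks ih =>
    rw [List.flatMap_cons, ← ih, pyramids, List.map_cons, List.sum_cons]
    rfl

theorem semilength_pyramids (ks : List ℕ) : (pyramids ks).semilength = ks.sum := by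
  induction ks with
  | nil => rfl
  | cons k ks ih =>
    rw [List.sum_cons, ← ih, pyramids, List.map_cons, List.sum_cons, DyckWord.semilength_add]
    congr 1
    simp [DyckWord.semilength, pyramid, pyramidWord, List.count_append, List.count_replicate]

theorem takeWhile_pyramidWord_append {k : ℕ} (hk : k ≠ 0) (l : List DyckStep) :
    (pyramidWord k ++ l).takeWhile (· = DyckStep.U) = List.replicate k DyckStep.U := by
  obtain ⟨k, rfl⟩ := Nat.exists_eq_succ_of_ne_zero hk
  rw [pyramidWord, List.append_assoc, List.takeWhile_append_of_pos (by simp)]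
  simp [List.replicate_succ]

/-- The first ascent of the path gives the first part. Empty pyramids would be invisible, so the
parts must be nonzero. -/
theorem pyramids_injective {ks ks' : List ℕ} (hks : ∀ k ∈ ks, k ≠ 0) (hks' : ∀ k ∈ ks', k ≠ 0)
    (h : pyramids ks = pyramids ks') : ks = ks' := by
  replace h := congrArg DyckWord.toList h
  rw [toList_pyramids, toList_pyramids] at h
  induction ks generalizing ks' with
  | nil =>
    rcases ks' with _ | ⟨k', ks'⟩
    · rfl
    · have := hks' k' List.mem_cons_self
      simp [pyramidWord, this] at h
  | cons k ks ih =>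
    have hk := hks k List.mem_cons_self
    rcases ks' with _ | ⟨k', ks'⟩
    · simp [pyramidWord, hk] at h
    · have hk' := hks' k' List.mem_cons_self
      rw [List.flatMap_cons, List.flatMap_cons] at h
      have h1 := congrArg (List.takeWhile (· = DyckStep.U)) h
      rw [takeWhile_pyramidWord_append hk, takeWhile_pyramidWord_append hk'] at h1
      obtain rfl : k = k' := by simpa using congrArg List.length h1
      rw [ih (fun x hx => hks x (List.mem_cons_of_mem _ hx))
        (fun x hx => hks' x (List.mem_cons_of_mem _ hx)) (List.append_cancel_left h)]

theorem pyramids_mem_fibonacciPaths {m : ℕ} {ks : List ℕ} (h : ∀ k ∈ ks, 1 ≤ k ∧ k ≤ m) :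
    pyramids ks ∈ fibonacciPaths m ks.sum :=
  ⟨semilength_pyramids ks, ks, h, toList_pyramids ks⟩

theorem exists_pyramids_of_mem_fibonacciPaths {m k : ℕ} {F : DyckWord}
    (h : F ∈ fibonacciPaths m k) :
    ∃ ks, (∀ j ∈ ks, 1 ≤ j ∧ j ≤ m) ∧ ks.sum = k ∧ pyramids ks = F := by
  obtain ⟨h1, ks, h2, h3⟩ := h
  have h4 : pyramids ks = F := DyckWord.ext ((toList_pyramids ks).trans h3.symm)
  exact ⟨ks, h2, by rw [← semilength_pyramids, h4, h1], h4⟩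

/-! ### Coloured Dyck paths from words -/

/-- The Dyck path and the list of colours that a word encodes. -/
def lukColouredPath (w : List ℕ) : List DyckStep × List DyckWord :=
  (lukPath w, ((w.splitOn 0).filter (· ≠ [])).map pyramids)

theorem filter_map_sum {Bs : List (List ℕ)} (h : ∀ B ∈ Bs, ∀ k ∈ B, k ≠ 0) :
    (Bs.map List.sum).filter (fun k => 0 < k) = (Bs.filter (· ≠ [])).map List.sum := by
  rw [List.filter_map]
  congr 1
  refine List.filter_congr fun B hB => ?_
  rcases B with _ | ⟨k, B⟩
  · simp
  · have := h _ hB k List.mem_cons_self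
    simp
    omega

theorem ascentLengths_lukPath (w : List ℕ) :
    ascentLengths (lukPath w) = ((w.splitOn 0).filter (· ≠ [])).map List.sum := by
  rw [ascentLengths, splitOn_lukPath,
    ← filter_map_sum fun B hB k hk => ((List.splitOn_letters 0 w).1 B hB k hk).1]
  simp [Function.comp_def]

/-- The colours forget where the empty blocks stand, and the block sums restore these positions,
since nonzero letters make a zero sum possible only for an empty block. -/
theorem blocks_injective {Bs Bs' : List (List ℕ)} (h : ∀ B ∈ Bs, ∀ k ∈ B, k ≠ 0)
    (h' : ∀ B ∈ Bs', ∀ k ∈ B, k ≠ 0) (hsum : Bs.map List.sum = Bs'.map List.sum)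
    (hpyr : (Bs.filter (· ≠ [])).map pyramids = (Bs'.filter (· ≠ [])).map pyramids) :
    Bs = Bs' := by
  have hzero : ∀ B : List ℕ, (∀ k ∈ B, k ≠ 0) → B.sum = 0 → B = [] := by
    intro B hB h0
    rcases B with _ | ⟨k, B⟩
    · rfl
    · have := hB k List.mem_cons_self
      rw [List.sum_cons] at h0
      omega
  induction Bs generalizing Bs' with
  | nil => exact (List.map_eq_nil_iff.1 hsum.symm).symm
  | cons B Bs ih =>
    rcases Bs' with _ | ⟨B', Bs'⟩
    · simp at hsum
    · rw [List.forall_mem_cons] at h h'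
      rw [List.map_cons, List.map_cons, List.cons.injEq] at hsum
      by_cases hB : B = []
      · subst hB
        obtain rfl := hzero B' h'.1 (by rw [← hsum.1, List.sum_nil])
        rw [ih h.2 h'.2 hsum.2 (by simpa using hpyr)]
      · have hB' : B' ≠ [] := by
          rintro rfl
          exact hB (hzero B h.1 (by rw [hsum.1, List.sum_nil]))
        rw [List.filter_cons_of_pos (by simpa using hB),
          List.filter_cons_of_pos (by simpa using hB'), List.map_cons, List.map_cons,
          List.cons.injEq] at hpyr
        rw [ih h.2 h'.2 hsum.2 hpyr.2, pyramids_injective h.1 h'.1 hpyr.1]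

theorem exists_blocks {m : ℕ} {ks : List ℕ} {c : List DyckWord}
    (h : List.Forall₂ (fun k C => C ∈ fibonacciPaths m k) (ks.filter (fun k => 0 < k)) c) :
    ∃ Bs : List (List ℕ), (∀ B ∈ Bs, ∀ j ∈ B, 1 ≤ j ∧ j ≤ m) ∧ Bs.map List.sum = ks ∧
      (Bs.filter (· ≠ [])).map pyramids = c := by
  induction ks generalizing c with
  | nil =>
    rw [List.filter_nil, List.forall₂_nil_left_iff] at h
    exact ⟨[], by simp, rfl, by simp [h]⟩
  | cons k ks ih =>
    rcases Nat.eq_zero_or_pos k with rfl | hk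
    · obtain ⟨Bs, h1, h2, h3⟩ := ih (by simpa using h)
      exact ⟨[] :: Bs, by simpa using h1, by simp [h2], by simpa using h3⟩
    · rw [List.filter_cons_of_pos (by simpa using hk), List.forall₂_cons_left_iff] at h
      obtain ⟨C, c', hC, hc', rfl⟩ := h
      obtain ⟨B, hB1, hB2, rfl⟩ := exists_pyramids_of_mem_fibonacciPaths hC
      obtain ⟨Bs, h1, h2, h3⟩ := ih hc'
      have hB : B ≠ [] := by
        rintro rfl
        simp at hB2
        omega
      exact ⟨B :: Bs, List.forall_mem_cons.2 ⟨hB1, h1⟩, by simp [hB2, h2], by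
        rw [List.filter_cons_of_pos (by simpa using hB), List.map_cons, h3]⟩

/-- The underlying list of the Dyck word is used because `lukPath` is a bare list, defined for all
words. -/
theorem bijOn_lukColouredPath (m n : ℕ) :
    Set.BijOn lukColouredPath {w | IsLuk m 1 (w ++ [0]) ∧ w.count 0 = n}
      (Set.image (fun P : DyckWord × List DyckWord => (P.1.toList, P.2))
        (colouredDyckPaths (fibonacciPaths m) n)) := by
  refine ⟨?_, ?_, ?_⟩
  · rintro w ⟨hw, hn⟩
    obtain ⟨hm, hD⟩ := isLuk_concat_zero_iff.1 hw
    obtain ⟨P, hP⟩ := hD.exists_dyckWord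
    refine ⟨(P, (lukColouredPath w).2), ⟨?_, ?_⟩, by simp only [hP, lukColouredPath]⟩
    · rw [DyckWord.semilength_eq_count_D, hP, count_D_lukPath, hn]
    · simp only
      rw [hP, ascentLengths_lukPath, lukColouredPath, List.forall₂_map_left_iff,
        List.forall₂_map_right_iff, List.forall₂_same]
      intro B hB
      refine pyramids_mem_fibonacciPaths fun k hk => ?_
      have := (List.splitOn_letters 0 w).1 B (List.mem_of_mem_filter hB) k hk
      exact ⟨Nat.one_le_iff_ne_zero.2 this.1, hm k this.2⟩
  · intro w _ w' _ h
    obtain ⟨h1, h2⟩ := Prod.mk.inj h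
    have h3 := congrArg (fun l => (l.splitOn DyckStep.D).map List.length) h1
    simp only [splitOn_lukPath, List.map_map, Function.comp_def, List.length_replicate] at h3
    rw [← List.intercalate_splitOn (xs := w) 0, ← List.intercalate_splitOn (xs := w') 0,
      blocks_injective (fun B hB k hk => ((List.splitOn_letters 0 w).1 B hB k hk).1)
        (fun B hB k hk => ((List.splitOn_letters 0 w').1 B hB k hk).1) h3 h2]
  · rintro _ ⟨⟨P, c⟩, ⟨hP, hc⟩, rfl⟩
    obtain ⟨Bs, h1, h2, h3⟩ := exists_blocks hc
    -- Splitting always yields at least one piece, even for the empty path; without this, joining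
    -- the blocks and splitting again would not return `Bs`.
    have hne : Bs ≠ [] := by
      rintro rfl
      exact List.splitOn_ne_nil _ _ (List.map_eq_nil_iff.1 h2.symm)
    have hsplit : ([0].intercalate Bs).splitOn 0 = Bs :=
      List.splitOn_intercalate 0 (fun B hB h0 => absurd (h1 B hB 0 h0).1 (by omega)) hne
    set w := [0].intercalate Bs
    have hpath : lukPath w = P.toList := by
      rw [← List.intercalate_splitOn (xs := lukPath w) DyckStep.D,
        ← List.intercalate_splitOn (xs := P.toList) DyckStep.D, splitOn_lukPath, hsplit]
      congr 1
      rw [show (fun B : List ℕ => List.replicate B.sum DyckStep.U) =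
        (fun k => List.replicate k DyckStep.U) ∘ List.sum from rfl, ← List.map_map, h2,
        List.map_map]
      refine (List.map_congr_left fun L hL => ?_).trans (List.map_id _)
      exact (List.eq_replicate_iff.2 ⟨rfl, fun s hs => DyckStep.eq_U_of_ne_D
        ((List.splitOn_letters DyckStep.D P.toList).1 L hL s hs).1⟩).symm
    refine ⟨w, ⟨isLuk_concat_zero_iff.2 ⟨fun j hj => ?_, ?_⟩, ?_⟩, ?_⟩
    · rcases (List.splitOn_letters 0 w).2 j hj with rfl | ⟨B, hB, hjB⟩
      · exact Nat.zero_le m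
      · rw [hsplit] at hB
        exact (h1 B hB j hjB).2
    · rw [hpath]
      exact P.isDyckFrom
    · rw [← count_D_lukPath, hpath, ← DyckWord.semilength_eq_count_D]
      exact hP
    · rw [lukColouredPath, hpath, hsplit, h3]

theorem bijOn_concat_zero (m n : ℕ) :
    Set.BijOn (· ++ [0]) {w | IsLuk m 1 (w ++ [0]) ∧ w.count 0 = n} (lukWords m n 1) := by
  refine ⟨?_, fun w _ w' _ h => List.append_cancel_right h, ?_⟩
  · rintro w ⟨h1, h2⟩
    exact ⟨h1, by simp [h2]⟩
  · rintro w ⟨h1, h2⟩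
    obtain ⟨w, rfl⟩ := h1.exists_eq_concat
    exact ⟨w, ⟨h1, by simpa using h2⟩, rfl⟩

theorem colouredDyckPaths_finite_and_ncard (m n : ℕ) :
    (colouredDyckPaths (fibonacciPaths m) n).Finite ∧
      ((colouredDyckPaths (fibonacciPaths m) n).ncard : ℚ) = forestCount m n 1 := by
  have hinj : Set.InjOn (fun P : DyckWord × List DyckWord => (P.1.toList, P.2))
      (colouredDyckPaths (fibonacciPaths m) n) := fun P _ Q _ h =>
    Prod.ext (DyckWord.ext (Prod.mk.inj h).1) (Prod.mk.inj h).2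
  obtain ⟨h1, h2⟩ := hinj.bijOn_image.finite_and_ncard_eq
  obtain ⟨h3, h4⟩ := (bijOn_lukColouredPath m n).finite_and_ncard_eq
  obtain ⟨h5, h6⟩ := (bijOn_concat_zero m n).finite_and_ncard_eq
  obtain ⟨h7, h8⟩ := lukWords_finite_and_ncard m n 1
  exact ⟨h1.2 (h3.1 (h5.2 h7)), by rw [h2, ← h4, h6, h8]⟩

theorem theorem3 (m n : ℕ) (hm : 1 ≤ m) :
    Nonempty (colouredDyckPaths (fibonacciPaths m) n ≃ dissections (n + 2) (m + 2)) ∧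
    (colouredDyckPaths (fibonacciPaths m) n).Finite ∧
    (dissections (n + 2) (m + 2)).Finite ∧
    (1 ≤ n →
      ((colouredDyckPaths (fibonacciPaths m) n).ncard : ℚ) = dissectionSum m n ∧
      ((dissections (n + 2) (m + 2)).ncard : ℚ) = dissectionSum m n) := by
  obtain ⟨h1, h2⟩ := colouredDyckPaths_finite_and_ncard m n
  obtain ⟨h3, h4⟩ := dissections_finite_and_ncard m n
  refine ⟨?_, h1, h3, fun hn => ?_⟩
  · have := h1.to_subtype
    have := h3.to_subtype
    -- Both sets have `forestCount m n 1` elements, also for `n = 0`, so equal finite cardinality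
    -- supplies the bijection.
    refine ⟨(Finite.equivFin _).trans ((finCongr ?_).trans (Finite.equivFin _).symm)⟩
    rw [Nat.card_coe_set_eq, Nat.card_coe_set_eq]
    exact_mod_cast h2.trans h4.symm
  · rw [h2, h4, forestCount_one (Nat.one_le_iff_ne_zero.1 hn)]
    exact ⟨rfl, rfl⟩
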